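/- Let $\mathcal X$ be a real Banach space that is smooth and $p$-convex for some $p\ge 2$: every $x\neq 0$ has exactly one $\xi\in\mathcal X^*$ with $\xi(x)=\|x\|$, $\|\xi\|=1$, and there is $K>0$ with $\inf\{1-\tfrac12\|z+w\|:\|z\|=\|w\|=1,\ \|z-w\|\ge\tau\}\ge K\tau^p$ for all $\tau\in(0,2]$. Let $p^*=p/(p-1)$. For $s>1$ and a Banach space $E$ let $J_s^{E}(x)=\{\xi\in E^*:\xi(x)=\|x\|\|\xi\|,\ \|\xi\|=\|x\|^{s-1}\}$ be the duality map, and, where $J_s^E$ is single-valued, let $D_s(z,w)=\frac1{s^*}\|z\|^s+\frac1s\|w\|^s-\langle J_s^E(z),w\rangle$ be the Bregman distance, $\frac1s+\frac1{s^*}=1$. Call $G>0$ admissible if $D_{p^*}(z^*,w^*)\le \frac{G}{p^*}\|w^*-z^*\|^{p^*}$ for all $z^*,w^*\in\mathcal X^*$. Let $\mathcal Y_1,\dots,\mathcal Y_N$ ($N\ge1$) be real Banach spaces, $A_i:\mathcal X\to\mathcal Y_i$ bounded linear operators, and $A=(A_1,\dots,A_N):\mathcal X\to\mathcal Y$, where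 $\mathcal Y=\mathcal Y_1\times\dots\times\mathcal Y_N$ carries the $\ell^r$ norm, $1\le r\le\infty$. Let $y=(y_1,\dots,y_N)\in\mathrm{range}(A)$, $L_{\max}=\max_i\|A_i\|$, and let $\mathcal X_{\min}$ be the set of minimisers of $x\mapsto\frac1p\|Ax-y\|^p$ over $\mathcal X$ (that is, the set of solutions of $Ax=y$). Let $1<q\le2$, and for each $i$ let $j_q^i:\mathcal Y_i\to\mathcal Y_i^*$ be a single-valued selection of $J_q^{\mathcal Y_i}$. Let $i_1,i_2,\dots$ be independent random indices, uniformly distributed on $\{1,\dots,N\}$, let $x_0\in\mathcal X$ be deterministic, and let $$x_{k+1}=J_{p^*}^{\mathcal X^*}\Big(J_p^{\mathcal X}(x_k)-\mu_{k+1}A_{i_{k+1}}^*\,j_q^{i_{k+1}}\big(A_{i_{k+1}}x_k-y_{i_{k+1}}\big)\Big),\qquad k=0,1,\dots,$$ where $\mathcal X^{**}$ is identified with $\mathcal X$. Let the step sizes $\mu_k>0$ satisfy $\sum_{k\ge1}\mu_k=\infty$ and $\sum_{k\ge1}\mu_k^{p^*}<\infty$. Then an admissible constant exists, and for every admissible $G_{p^*}$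 such that $\mu_k^{p^*-1}\,G_{p^*}L_{\max}^{p^*}<p^*$ for all $k\ge1$, the following hold. 1. The sequence $(x_k)$ converges almost surely to a solution: almost surely there is a (random) $\hat x$ with $A\hat x=y$ and $x_k\to\hat x$ in norm; in particular $$\mathbb P\Big(\lim_{k\to\infty}\inf_{\tilde x\in\mathcal X_{\min}}\|x_k-\tilde x\|=0\Big)=1.$$ 2. Let $x^\dagger$ be the minimum norm solution, i.e. $Ax^\dagger=y$ and $\|x^\dagger\|=\inf\{\|x\|:Ax=y\}$. If $J_p^{\mathcal X}(x_0)\in\overline{\mathrm{range}(A^*)}$, then $\lim_{k\to\infty}D_p(x_k,x^\dagger)=0$ almost surely, every $D_p(x_k,x^\dagger)$ is integrable, and $\lim_{k\to\infty}\mathbb E[D_p(x_k,x^\dagger)]=0$. -/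

import Mathlib

open Filter Topology MeasureTheory ProbabilityTheory
open scoped ENNReal

noncomputable section

namespace BanachSGD

universe u v

section Geometry

variable (E : Type u) [NormedAddCommGroup E] [NormedSpace ℝ E]

/-- The modulus of convexity
`δ_E(τ) = inf {1 - ‖z + w‖ / 2 : ‖z‖ = ‖w‖ = 1, ‖z - w‖ ≥ τ}`.
It is extended-real-valued, so that the infimum over the empty set is `+∞`. -/
def modulusOfConvexity (τ : ℝ) : EReal :=
  sInf {t : EReal | ∃ z w : E, ‖z‖ = 1 ∧ ‖w‖ = 1 ∧ τ ≤ ‖z - w‖ ∧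
    t = ((1 - ‖z + w‖ / 2 : ℝ) : EReal)}

/-- `E` is `p`-convex: `δ_E(τ) ≥ K τ ^ p` on `(0, 2]` for some `K > 0`. -/
def IsPConvex (p : ℝ) : Prop :=
  ∃ K : ℝ, 0 < K ∧ ∀ τ : ℝ, 0 < τ → τ ≤ 2 →
    ((K * τ ^ p : ℝ) : EReal) ≤ modulusOfConvexity E τ

/-- `E` is smooth: every nonzero vector has exactly one norming functional of norm one. -/
def IsSmoothSpace : Prop :=
  ∀ x : E, x ≠ 0 → ∃! ξ : StrongDual ℝ E, ξ x = ‖x‖ ∧ ‖ξ‖ = 1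

variable {E}

/-- The (set-valued) duality map with gauge function `t ↦ t ^ (p - 1)`. -/
def dualityMap (p : ℝ) (x : E) : Set (StrongDual ℝ E) :=
  {ξ | ξ x = ‖x‖ * ‖ξ‖ ∧ ‖ξ‖ = ‖x‖ ^ (p - 1)}

theorem dualityMap_nonempty {p : ℝ} (hp : 1 < p) (x : E) : (dualityMap p x).Nonempty := by
  have hp' : p - 1 ≠ 0 := by linarith
  by_cases hx : x = 0
  · subst hx
    exact ⟨0, by simp, by simp [Real.zero_rpow hp']⟩
  · obtain ⟨g, hg1, hg2⟩ := exists_dual_vector ℝ x (norm_ne_zero_iff.mpr hx)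
    have h0 : (0 : ℝ) ≤ ‖x‖ ^ (p - 1) := Real.rpow_nonneg (norm_nonneg x) _
    refine ⟨(‖x‖ ^ (p - 1)) • g, ?_, ?_⟩
    · have hg2' : g x = ‖x‖ := by simpa using hg2
      rw [norm_smul, hg1, Real.norm_of_nonneg h0]
      simp [hg2', mul_comm]
    · rw [norm_smul, hg1, Real.norm_of_nonneg h0, mul_one]

/-- A selection of the duality map. On a smooth space and for `1 < p` the duality map is
single-valued, and this is its value. -/
def dualityFun (p : ℝ) (x : E) : StrongDual ℝ E :=
  Classical.epsilon fun ξ => ξ ∈ dualityMap p x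

theorem dualityFun_mem {p : ℝ} (hp : 1 < p) (x : E) : dualityFun p x ∈ dualityMap p x :=
  Classical.epsilon_spec (p := fun ξ => ξ ∈ dualityMap p x) (dualityMap_nonempty hp x)

/-- The Bregman distance
`D_p(z, w) = ‖z‖ ^ p / p* + ‖w‖ ^ p / p - ⟨J_p z, w⟩`, where `1 / p + 1 / p* = 1`. -/
def bregman (p : ℝ) (z w : E) : ℝ :=
  1 / p.conjExponent * ‖z‖ ^ p + 1 / p * ‖w‖ ^ p - dualityFun p z w

/-- The duality map `J_{p*}` of the dual space, regarded as a map into `E` through the canonical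
embedding of `E` into its bidual: the point `x` of `E` whose image in the bidual lies in
`J_{p*}(ξ)`. (Such an `x` exists when `E` is reflexive, in particular when `E` is a `p`-convex
Banach space.) -/
def dualDualityFun (p : ℝ) (ξ : StrongDual ℝ E) : E :=
  Classical.epsilon fun x : E =>
    NormedSpace.inclusionInDoubleDual ℝ E x ∈ dualityMap p.conjExponent ξ

variable (E) in
/-- `G` is an admissible `p*`-smoothness constant of the dual of `E`: `G > 0` and
`D_{p*}(z, w) ≤ (G / p*) ‖w - z‖ ^ p*` for all `z, w` in the dual of `E`. -/
def IsDualSmoothnessConst (p G : ℝ) : Prop :=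
  0 < G ∧ ∀ z w : StrongDual ℝ E,
    bregman p.conjExponent z w ≤ 1 / p.conjExponent * G * ‖w - z‖ ^ p.conjExponent

end Geometry

section Problem

variable {X : Type u} [NormedAddCommGroup X] [NormedSpace ℝ X]

section Single

variable {Z : Type v} [NormedAddCommGroup Z] [NormedSpace ℝ Z]

/-- The range of the adjoint `T* : Z* → X*`, `T* η = η ∘ T`. -/
def adjointRange (T : X →L[ℝ] Z) : Set (StrongDual ℝ X) :=
  Set.range fun η : StrongDual ℝ Z => η.comp T

/-- The minimisers over `X` of the objective `‖T x - y‖ ^ p / p`. -/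
def minimisers (p : ℝ) (T : X →L[ℝ] Z) (y : Z) : Set X :=
  {x | IsMinOn (fun x' => 1 / p * ‖T x' - y‖ ^ p) Set.univ x}

/-- `x` is a minimum norm solution of `T x = y`. -/
def IsMinNormSolution (T : X →L[ℝ] Z) (y : Z) (x : X) : Prop :=
  T x = y ∧ ‖x‖ = sInf {t : ℝ | ∃ x' : X, T x' = y ∧ t = ‖x'‖}

end Single

variable {N : ℕ} {Y : Fin N → Type v} [∀ j, NormedAddCommGroup (Y j)] [∀ j, NormedSpace ℝ (Y j)]

/-- The operator `A x = (A_1 x, …, A_N x)` into the product of the `Y_j` with the `ℓ^r` norm. -/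
def stack (r : ℝ≥0∞) [Fact (1 ≤ r)] (A : ∀ j, X →L[ℝ] Y j) : X →L[ℝ] PiLp r Y :=
  ((PiLp.continuousLinearEquiv r ℝ Y).symm : (∀ j, Y j) →L[ℝ] PiLp r Y).comp
    (ContinuousLinearMap.pi A)

/-- The Kaczmarz iterates
`x_{k+1} = J_{p*}(J_p(x_k) - μ_{k+1} A_i* (jY_i (A_i x_k - y_i)))`, `i = idx (k + 1)`,
with the initial value `x₀`, the step sizes `μ`, and the selections `jY_i` of duality maps
of the spaces `Y_i`. -/
def iterates (p : ℝ) (A : ∀ j, X →L[ℝ] Y j) (y : ∀ j, Y j)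
    (jY : ∀ j, Y j → StrongDual ℝ (Y j)) (μ : ℕ → ℝ) (x₀ : X) (idx : ℕ → Fin N) : ℕ → X
  | 0 => x₀
  | k + 1 =>
    let x := iterates p A y jY μ x₀ idx k
    let i := idx (k + 1)
    dualDualityFun p (dualityFun p x - μ (k + 1) • (jY i (A i x - y i)).comp (A i))

end Problem

end BanachSGD

end

/-! Each step is a subtraction in the dual space: with `ξ_k = J_p x_k`, smoothness of the space gives
`ξ_{k+1} = ξ_k - μ_{k+1} A_i* j_i`. Two facts about a `p`-convex Banach space carry the argument.
`exists_mul_rpow_norm_sub_le` says that `D_p (u, x) ≥ c ‖x - u‖ ^ p`, and its conjugate dual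
`exists_dual_smoothness` says that the dual space is `p*`-smooth, which is the existence of an
admissible constant. Reflexivity is not needed as a theorem: functionals attain their norm
(`exists_mem_dualityMap`), and `J_{p*}` is single-valued on the dual with values in the space
(`eq_inclusionInDoubleDual`).

An admissible constant gives, on every path and for every solution `v`, the descent estimate
`D_p (x_{k+1}, v) ≤ D_p (x_k, v) - c μ_{k+1} ‖A_i x_k - y_i‖ ^ q + B μ_{k+1} ^ p*`
(`bregman_step_le`, `exists_descent_factor`). Hence `D_p (x_k, v)` is bounded by a constant and
converges, and `∑ μ_{k+1} ‖A_i x_k - y_i‖ ^ q` is bounded by a constant, on every path. Chance only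
enters in passing from the chosen residual to the sum of all residuals: `x_k` depends on the first
`k` indices, so the two have the same mean up to the factor `N`, and the weighted total residuals
are almost surely summable (`ae_summable_totalResidual`). No martingale theorem is involved.

On a path with this summability, the total residual has infimum `0` since `∑ μ_k = ∞`. Along its
running minima the three-point identity shows that the iterates are Cauchy, their limit `z` is a
solution, and `D_p (x_k, z)`, which converges, tends to `0`; so `x_k → z`
(`IsKaczmarzSeq.exists_tendsto`).

If `J_p x_0` lies in the closure of the range of `A*`, all `ξ_k` agree on solutions, so that
`D_p (x_k, v) ≤ D_p (x_k, z)` for a minimum norm solution `v` (`IsKaczmarzSeq.bregman_le`), and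
convergence of the means follows by dominated convergence. -/

namespace BanachSGD

/-! ### Two scalar inequalities -/

theorem abs_sub_one_rpow_le {p t : ℝ} (hp : 2 ≤ p) (ht : 0 ≤ t) :
    |t - 1| ^ p ≤ t ^ p - 1 - p * (t - 1) := by
  have hq : 1 ≤ p / 2 := by linarith
  have e1 : |t - 1| ^ p = ((t - 1) ^ 2) ^ (p / 2) := by
    rw [← sq_abs, ← Real.rpow_natCast, ← Real.rpow_mul (abs_nonneg _)]
    congr 1; push_cast; ring
  have e2 : t ^ p = (t ^ 2) ^ (p / 2) := by
    rw [← Real.rpow_natCast, ← Real.rpow_mul ht]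
    congr 1; push_cast; ring
  rw [e1, e2]
  rcases le_total (1 / 2) t with h | h
  · -- `t ^ 2 = (1 + 2 (t - 1)) + (t - 1) ^ 2`, and `v ↦ v ^ (p / 2)` is superadditive
    have h1 := one_add_mul_self_le_rpow_one_add (s := 2 * (t - 1)) (by linarith) hq
    have h2 := Real.add_rpow_le_rpow_add (a := 1 + 2 * (t - 1)) (b := (t - 1) ^ 2)
      (by linarith) (sq_nonneg _) hq
    have h3 : 1 + 2 * (t - 1) + (t - 1) ^ 2 = t ^ 2 := by ring
    rw [h3] at h2
    linarith
  · -- `t ^ 2 = V (1 - a / V)` with `V = (t - 1) ^ 2 ≤ 1` and `a = 1 - 2 t`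
    set V := (t - 1) ^ 2 with hV
    have hV0 : 0 < V := by rw [hV]; nlinarith
    have hV1 : V ≤ 1 := by rw [hV]; nlinarith
    have ha : 1 - 2 * t ≤ V := by rw [hV]; nlinarith
    have h1 := one_add_mul_self_le_rpow_one_add (s := -((1 - 2 * t) / V))
      (by rw [neg_le_neg_iff, div_le_one hV0]; exact ha) hq
    have h2 : (t ^ 2) ^ (p / 2) = V ^ (p / 2) * (1 + -((1 - 2 * t) / V)) ^ (p / 2) := by
      rw [← Real.mul_rpow hV0.le]
      · congr 1; field_simp; rw [hV]; ring
      · have : (1 - 2 * t) / V ≤ 1 := by rw [div_le_one hV0]; exact ha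
        linarith
    have h3 : V ^ (p / 2) ≤ V := by
      simpa using Real.rpow_le_rpow_of_exponent_ge hV0 hV1 hq
    have h5 : 0 ≤ V ^ (p / 2) := Real.rpow_nonneg hV0.le _
    have h4 : V ^ (p / 2) * ((1 - 2 * t) / V) ≤ 1 - 2 * t := by
      rw [← mul_div_assoc, div_le_iff₀ hV0, mul_comm]
      exact mul_le_mul_of_nonneg_left h3 (by linarith)
    rw [h2]
    nlinarith [mul_le_mul_of_nonneg_left h1 h5,
      mul_le_mul_of_nonneg_left h4 (by linarith : (0 : ℝ) ≤ p / 2)]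

theorem add_rpow_le_two_rpow_mul {p a b : ℝ} (hp : 0 ≤ p) (ha : 0 ≤ a) (hb : 0 ≤ b) :
    (a + b) ^ p ≤ 2 ^ p * (a ^ p + b ^ p) := by
  have h1 : (a + b) ^ p ≤ (2 * max a b) ^ p := by
    apply Real.rpow_le_rpow (by positivity) _ hp
    linarith [le_max_left a b, le_max_right a b]
  rw [Real.mul_rpow (by norm_num) (le_max_of_le_left ha)] at h1
  refine h1.trans (mul_le_mul_of_nonneg_left ?_ (by positivity))
  have h2 := Real.rpow_nonneg ha p
  have h3 := Real.rpow_nonneg hb p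
  rcases max_choice a b with h | h <;> rw [h] <;> linarith

/-! ### Duality maps -/

section Duality

variable {E : Type*} [NormedAddCommGroup E] [NormedSpace ℝ E] {p s : ℝ}

theorem dualityMap_apply_self (hps : p.HolderConjugate s) {x : E} {ξ : StrongDual ℝ E}
    (h : ξ ∈ dualityMap p x) : ξ x = ‖x‖ ^ p := by
  rw [h.1, h.2]
  rcases eq_or_ne ‖x‖ 0 with h0 | h0
  · rw [h0, zero_mul, Real.zero_rpow hps.ne_zero]
  · rw [Real.rpow_sub_one h0]
    field_simp

theorem dualityMap_norm_rpow (hps : p.HolderConjugate s) {x : E} {ξ : StrongDual ℝ E}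
    (h : ξ ∈ dualityMap p x) : ‖ξ‖ ^ s = ‖x‖ ^ p := by
  rw [h.2, ← Real.rpow_mul (norm_nonneg _), hps.sub_one_mul_conj]

/-- The duality maps `J_p` of `E` and `J_s` of its dual are inverse to each other when `s` is the
conjugate exponent. -/
theorem inclusionInDoubleDual_mem_dualityMap_iff (hps : p.HolderConjugate s) {x : E}
    {ξ : StrongDual ℝ E} :
    NormedSpace.inclusionInDoubleDual ℝ E x ∈ dualityMap s ξ ↔ ξ ∈ dualityMap p x := by
  have hn : ‖NormedSpace.inclusionInDoubleDual ℝ E x‖ = ‖x‖ :=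
    (NormedSpace.inclusionInDoubleDualLi ℝ (E := E)).norm_map x
  simp only [dualityMap, Set.mem_ofPred_eq, hn, NormedSpace.dual_def]
  rw [mul_comm ‖ξ‖]
  refine and_congr_right fun _ => ⟨fun h => ?_, fun h => ?_⟩
  · rw [h, ← Real.rpow_mul (norm_nonneg _)]
    have : (s - 1) * (p - 1) = 1 := by linarith [hps.mul_eq_add]
    rw [this, Real.rpow_one]
  · rw [h, ← Real.rpow_mul (norm_nonneg _)]
    have : (p - 1) * (s - 1) = 1 := by linarith [hps.mul_eq_add]
    rw [this, Real.rpow_one]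

theorem dualityMap_unique (hsm : IsSmoothSpace E) (hp : 1 < p) {x : E} {ξ η : StrongDual ℝ E}
    (hξ : ξ ∈ dualityMap p x) (hη : η ∈ dualityMap p x) : ξ = η := by
  rcases eq_or_ne x 0 with rfl | hx
  · have h0 : ∀ ζ : StrongDual ℝ E, ζ ∈ dualityMap p (0 : E) → ζ = 0 := by
      intro ζ hζ
      have := hζ.2
      rw [norm_zero, Real.zero_rpow (by linarith)] at this
      exact norm_eq_zero.1 this
    rw [h0 ξ hξ, h0 η hη]
  · have hpos : 0 < ‖x‖ ^ (p - 1) := Real.rpow_pos_of_pos (norm_pos_iff.2 hx) _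
    have key : ∀ ζ : StrongDual ℝ E, ζ ∈ dualityMap p x →
        (‖x‖ ^ (p - 1))⁻¹ • ζ ∈ {ζ : StrongDual ℝ E | ζ x = ‖x‖ ∧ ‖ζ‖ = 1} := by
      intro ζ hζ
      refine ⟨?_, ?_⟩
      · simp only [smul_apply, smul_eq_mul, hζ.1, hζ.2]
        field_simp
      · rw [norm_smul, hζ.2, norm_inv, Real.norm_of_nonneg hpos.le, inv_mul_cancel₀ hpos.ne']
    have := (hsm x hx).unique (key ξ hξ) (key η hη)
    exact smul_right_injective _ (inv_ne_zero hpos.ne') this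

theorem dualityFun_eq (hsm : IsSmoothSpace E) (hp : 1 < p) {x : E} {ξ : StrongDual ℝ E}
    (hξ : ξ ∈ dualityMap p x) : dualityFun p x = ξ :=
  dualityMap_unique hsm hp (dualityFun_mem hp x) hξ

end Duality

/-! ### `p`-convexity: lower bound for the Bregman distance and norm attainment -/

section Convexity

theorem norm_add_le_of_modulus {E : Type*} [NormedAddCommGroup E] {p K : ℝ}
    (hp : 0 < p)
    (hK : ∀ τ : ℝ, 0 < τ → τ ≤ 2 → ((K * τ ^ p : ℝ) : EReal) ≤ modulusOfConvexity E τ)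
    {z w : E} (hz : ‖z‖ = 1) (hw : ‖w‖ = 1) : ‖z + w‖ ≤ 2 - 2 * K * ‖z - w‖ ^ p := by
  rcases (norm_nonneg (z - w)).eq_or_lt with h | h
  · rw [← h, Real.zero_rpow hp.ne']
    linarith [norm_add_le z w]
  · have h1 : ((K * ‖z - w‖ ^ p : ℝ) : EReal) ≤ ((1 - ‖z + w‖ / 2 : ℝ) : EReal) :=
      (hK _ h (by linarith [norm_sub_le z w])).trans (sInf_le ⟨z, w, hz, hw, le_rfl, rfl⟩)
    have h2 := EReal.coe_le_coe_iff.1 h1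
    linarith

variable {E : Type*} [NormedAddCommGroup E] [NormedSpace ℝ E] {p s : ℝ}

/-- The case `‖u‖ = 1` of `exists_mul_rpow_norm_sub_le`. -/
theorem mul_rpow_norm_sub_le_of_norm_eq_one {K c : ℝ} (hp : 2 ≤ p) (hps : p.HolderConjugate s)
    (hK : ∀ τ : ℝ, 0 < τ → τ ≤ 2 → ((K * τ ^ p : ℝ) : EReal) ≤ modulusOfConvexity E τ)
    (hc1 : 2 ^ p * c ≤ 1 / p) (hc2 : 2 ^ p * c ≤ 2 * K) (hc : 0 < c)
    {u x : E} {w : StrongDual ℝ E} (hu : ‖u‖ = 1) (hw : ‖w‖ = 1) (hwu : w u = 1) :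
    c * ‖x - u‖ ^ p ≤ 1 / s + 1 / p * ‖x‖ ^ p - w x := by
  have hp0 : 0 < p := by linarith
  have hs : 1 / s = 1 - 1 / p := by
    have := hps.inv_add_inv_eq_one
    simp only [one_div]; linarith
  set t := ‖x‖ with ht
  have ht0 : 0 ≤ t := norm_nonneg x
  have hsc : 1 / p * |t - 1| ^ p ≤ 1 / s + 1 / p * t ^ p - t := by
    have := mul_le_mul_of_nonneg_left (abs_sub_one_rpow_le hp ht0) (by positivity : 0 ≤ 1 / p)
    have e : 1 / p * (t ^ p - 1 - p * (t - 1)) = 1 / s + 1 / p * t ^ p - t := by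
      rw [hs]; field_simp; ring
    linarith
  rcases eq_or_ne x 0 with hx | hx
  · have h2p : (1 : ℝ) ≤ 2 ^ p := Real.one_le_rpow (by norm_num) hp0.le
    have ht0' : t = 0 := by rw [ht, hx, norm_zero]
    rw [ht0'] at hsc
    rw [ht0', hx, zero_sub, norm_neg, hu, map_zero, Real.one_rpow]
    simp only [zero_sub, abs_neg, abs_one, Real.one_rpow, sub_zero, mul_one] at hsc ⊢
    nlinarith
  have htpos : 0 < t := norm_pos_iff.2 hx
  set e : E := t⁻¹ • x with he
  have hxe : x = t • e := by rw [he, smul_smul, mul_inv_cancel₀ htpos.ne', one_smul]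
  have hen : ‖e‖ = 1 := by
    rw [he, norm_smul, norm_inv, Real.norm_of_nonneg ht0, ← ht, inv_mul_cancel₀ htpos.ne']
  have h1 : w e ≤ 1 - 2 * K * ‖e - u‖ ^ p := by
    have h := norm_add_le_of_modulus hp0 hK hen hu
    have h' : w (e + u) ≤ ‖e + u‖ := by
      have := (le_abs_self _).trans (w.le_opNorm (e + u))
      rwa [hw, one_mul] at this
    rw [map_add, hwu] at h'
    linarith
  have hwx : w x = t * w e := by rw [hxe, map_smul, smul_eq_mul]
  have h2 : ‖x - u‖ ^ p ≤ 2 ^ p * (|t - 1| ^ p + t * ‖e - u‖ ^ p) := by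
    rcases le_total t 1 with h | h
    · have hb : ‖x - u‖ ≤ |t - 1| + t * ‖e - u‖ := by
        have : x - u = (t - 1) • u + t • (e - u) := by rw [hxe]; module
        rw [this]
        refine (norm_add_le _ _).trans (le_of_eq ?_)
        rw [norm_smul, norm_smul, hu, mul_one, Real.norm_eq_abs, Real.norm_of_nonneg ht0]
      refine (Real.rpow_le_rpow (norm_nonneg _) hb hp0.le).trans
        ((add_rpow_le_two_rpow_mul hp0.le (abs_nonneg _) (by positivity)).trans ?_)
      rw [Real.mul_rpow ht0 (norm_nonneg _)]
      have : t ^ p ≤ t := by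
        simpa using Real.rpow_le_rpow_of_exponent_ge htpos h (by linarith : 1 ≤ p)
      gcongr
    · have hb : ‖x - u‖ ≤ |t - 1| + ‖e - u‖ := by
        have : x - u = (t - 1) • e + (e - u) := by rw [hxe]; module
        rw [this]
        refine (norm_add_le _ _).trans (le_of_eq ?_)
        rw [norm_smul, hen, mul_one, Real.norm_eq_abs]
      refine (Real.rpow_le_rpow (norm_nonneg _) hb hp0.le).trans
        ((add_rpow_le_two_rpow_mul hp0.le (abs_nonneg _) (norm_nonneg _)).trans ?_)
      gcongr
      exact le_mul_of_one_le_left (by positivity) h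
  have h3 := mul_le_mul_of_nonneg_left h2 hc.le
  have h4 := mul_le_mul_of_nonneg_right hc1 (by positivity : 0 ≤ |t - 1| ^ p)
  have h5 := mul_le_mul_of_nonneg_right hc2 (by positivity : 0 ≤ t * ‖e - u‖ ^ p)
  have h6 := mul_le_mul_of_nonneg_left h1 ht0
  rw [hwx]
  nlinarith

/-- In a `p`-convex space the Bregman distance dominates the `p`-th power of the norm distance.
The reason is that for unit vectors `e`, `u` and a functional `w` norming `u` one has
`w e = w (e + u) - 1 ≤ ‖e + u‖ - 1`, which `p`-convexity bounds by `1 - 2 K ‖e - u‖ ^ p`. -/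
theorem exists_mul_rpow_norm_sub_le (hp : 2 ≤ p) (hps : p.HolderConjugate s)
    (hE : IsPConvex E p) :
    ∃ c : ℝ, 0 < c ∧ ∀ (u x : E) (w : StrongDual ℝ E), w ∈ dualityMap p u →
      c * ‖x - u‖ ^ p ≤ 1 / s * ‖u‖ ^ p + 1 / p * ‖x‖ ^ p - w x := by
  obtain ⟨K, hK0, hK⟩ := hE
  have hp0 : 0 < p := by linarith
  have h2p : (0 : ℝ) < 2 ^ p := by positivity
  have h2p1 : (1 : ℝ) ≤ 2 ^ p := Real.one_le_rpow (by norm_num) hp0.le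
  have hm : 0 < min (1 / p) (2 * K) := lt_min (by positivity) (by positivity)
  set c := min (1 / p) (2 * K) / 2 ^ p with hcdef
  have hcm : 2 ^ p * c = min (1 / p) (2 * K) := by rw [hcdef]; field_simp
  have hc1 : 2 ^ p * c ≤ 1 / p := hcm.le.trans (min_le_left _ _)
  have hc2 : 2 ^ p * c ≤ 2 * K := hcm.le.trans (min_le_right _ _)
  have hc : 0 < c := div_pos hm h2p
  refine ⟨c, hc, fun u x w hw => ?_⟩
  rcases eq_or_ne u 0 with rfl | hu
  · have hw0 : w = 0 := by
      have := hw.2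
      rw [norm_zero, Real.zero_rpow (by linarith)] at this
      exact norm_eq_zero.1 this
    rw [hw0, sub_zero, norm_zero, Real.zero_rpow hp0.ne']
    have : c ≤ 1 / p := by nlinarith
    simpa using mul_le_mul_of_nonneg_right this (by positivity : 0 ≤ ‖x‖ ^ p)
  · set ρ := ‖u‖ with hρ
    have hρ0 : 0 < ρ := norm_pos_iff.2 hu
    have hρp : 0 < ρ ^ p := Real.rpow_pos_of_pos hρ0 _
    have hρp1 : 0 < ρ ^ (p - 1) := Real.rpow_pos_of_pos hρ0 _
    have hsplit : ρ ^ p = ρ ^ (p - 1) * ρ := by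
      rw [Real.rpow_sub_one hρ0.ne']; field_simp
    have hnormsmul : ∀ v : E, ‖ρ⁻¹ • v‖ = ρ⁻¹ * ‖v‖ := fun v => by
      rw [norm_smul, norm_inv, Real.norm_of_nonneg hρ0.le]
    have key := mul_rpow_norm_sub_le_of_norm_eq_one hp hps hK hc1 hc2 hc
      (u := ρ⁻¹ • u) (x := ρ⁻¹ • x) (w := (ρ ^ (p - 1))⁻¹ • w)
      (by rw [hnormsmul, ← hρ, inv_mul_cancel₀ hρ0.ne'])
      (by rw [norm_smul, hw.2, norm_inv, Real.norm_of_nonneg hρp1.le, ← hρ,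
            inv_mul_cancel₀ hρp1.ne'])
      (by
        simp only [smul_apply, map_smul, smul_eq_mul, hw.1, hw.2, ← hρ]
        field_simp)
    rw [← smul_sub, hnormsmul, hnormsmul, Real.mul_rpow (by positivity) (norm_nonneg _),
      Real.mul_rpow (by positivity) (norm_nonneg _), Real.inv_rpow hρ0.le] at key
    simp only [smul_apply, map_smul, smul_eq_mul] at key
    have := mul_le_mul_of_nonneg_left key hρp.le
    calc c * ‖x - u‖ ^ p = ρ ^ p * (c * ((ρ ^ p)⁻¹ * ‖x - u‖ ^ p)) := by field_simp
      _ ≤ _ := this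
      _ = 1 / s * ρ ^ p + 1 / p * ‖x‖ ^ p - w x := by
        rw [mul_sub, mul_add]
        congr 1
        · field_simp
        · rw [hsplit]; field_simp

/-- In a `p`-convex Banach space every functional attains its norm: a maximising sequence of unit
vectors is Cauchy. -/
theorem exists_mem_dualityMap [CompleteSpace E] (hp : 2 ≤ p) (hps : p.HolderConjugate s)
    (hE : IsPConvex E p) (ξ : StrongDual ℝ E) : ∃ x : E, ξ ∈ dualityMap p x := by
  obtain ⟨K, hK0, hK⟩ := hE
  have hp0 : 0 < p := by linarith
  rcases eq_or_ne ξ 0 with rfl | hξ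
  · exact ⟨0, by simp, by simp [Real.zero_rpow (by linarith : p - 1 ≠ 0)]⟩
  set n := ‖ξ‖ with hn
  have hn0 : 0 < n := norm_pos_iff.2 hξ
  -- unit vectors on which `ξ` almost attains its norm
  have hex : ∀ k : ℕ, ∃ e : E, ‖e‖ = 1 ∧ n * (1 - 1 / ((k : ℝ) + 1)) ≤ ξ e := by
    intro k
    have hk : n * (1 - 1 / ((k : ℝ) + 1)) < ‖ξ‖ := by
      rw [← hn]
      have : 0 < 1 / ((k : ℝ) + 1) := by positivity
      nlinarith
    obtain ⟨v, hv1, hv2⟩ := ξ.exists_lt_apply_of_lt_opNorm hk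
    have hv0 : v ≠ 0 := by
      rintro rfl
      rw [map_zero, norm_zero] at hv2
      have : 1 / ((k : ℝ) + 1) ≤ 1 := by
        rw [div_le_one (by positivity)]; linarith [(Nat.cast_nonneg k : (0 : ℝ) ≤ k)]
      nlinarith
    have hvp : 0 < ‖v‖ := norm_pos_iff.2 hv0
    have hle : ‖ξ v‖ ≤ ‖v‖⁻¹ * ‖ξ v‖ :=
      le_mul_of_one_le_left (norm_nonneg _) ((one_le_inv₀ hvp).2 hv1.le)
    have hunit : ‖‖v‖⁻¹ • v‖ = 1 := by
      rw [norm_smul, norm_inv, norm_norm, inv_mul_cancel₀ hvp.ne']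
    rcases le_total 0 (ξ v) with h | h
    · refine ⟨‖v‖⁻¹ • v, hunit, ?_⟩
      rw [map_smul, smul_eq_mul]
      rw [Real.norm_of_nonneg h] at hle hv2
      linarith
    · refine ⟨-(‖v‖⁻¹ • v), by rw [norm_neg, hunit], ?_⟩
      rw [map_neg, map_smul, smul_eq_mul]
      rw [Real.norm_of_nonpos h] at hle hv2
      linarith
  choose e he1 he2 using hex
  have hcau : CauchySeq e := by
    rw [Metric.cauchySeq_iff]
    intro ε hε
    have hKε : 0 < K * ε ^ p := by positivity
    obtain ⟨M, hM⟩ := exists_nat_one_div_lt hKε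
    refine ⟨M, fun a ha b hb => ?_⟩
    have hab := norm_add_le_of_modulus hp0 hK (he1 a) (he1 b)
    have h1 : ξ (e a + e b) ≤ n * ‖e a + e b‖ := (le_abs_self _).trans (ξ.le_opNorm _)
    have hM' : ∀ k : ℕ, M ≤ k → 1 / ((k : ℝ) + 1) ≤ 1 / ((M : ℝ) + 1) := fun k hk =>
      Nat.one_div_le_one_div hk
    have h2 : n * (2 - 2 * (1 / ((M : ℝ) + 1))) ≤ n * ‖e a + e b‖ := by
      refine le_trans ?_ h1
      rw [map_add]
      have := he2 a
      have := he2 b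
      have := mul_le_mul_of_nonneg_left (hM' a ha) hn0.le
      have := mul_le_mul_of_nonneg_left (hM' b hb) hn0.le
      linarith
    have h3 := le_of_mul_le_mul_left h2 hn0
    have h4 : ‖e a - e b‖ ^ p < ε ^ p := by
      have : K * ‖e a - e b‖ ^ p < K * ε ^ p := by linarith
      exact lt_of_mul_lt_mul_left this hK0.le
    rw [dist_eq_norm]
    exact (Real.rpow_lt_rpow_iff (norm_nonneg _) hε.le hp0).1 h4
  obtain ⟨l, hl⟩ := cauchySeq_tendsto_of_complete hcau
  have hl1 : ‖l‖ = 1 := by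
    refine tendsto_nhds_unique hl.norm ?_
    simp [he1]
  have hξl : ξ l = n := by
    apply le_antisymm
    · have := (le_abs_self _).trans (ξ.le_opNorm l)
      rwa [hl1, mul_one] at this
    · have h1 : Tendsto (fun k : ℕ => n * (1 - 1 / ((k : ℝ) + 1))) atTop (𝓝 n) := by
        have := ((tendsto_one_div_add_atTop_nhds_zero_nat (𝕜 := ℝ)).const_sub 1).const_mul n
        simpa using this
      exact le_of_tendsto_of_tendsto' h1 ((ξ.continuous.tendsto l).comp hl) he2
  have hns : 0 < n ^ (s - 1) := Real.rpow_pos_of_pos hn0 _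
  refine ⟨n ^ (s - 1) • l, ?_, ?_⟩
  · rw [map_smul, smul_eq_mul, hξl, norm_smul, hl1, mul_one, Real.norm_of_nonneg hns.le]
  · rw [norm_smul, hl1, mul_one, Real.norm_of_nonneg hns.le, ← Real.rpow_mul hn0.le]
    have : (s - 1) * (p - 1) = 1 := by linarith [hps.mul_eq_add]
    rw [this, Real.rpow_one]

end Convexity

/-! ### Smoothness of the dual space -/

section DualSmoothness

variable {E : Type*} [NormedAddCommGroup E] [NormedSpace ℝ E] {p s : ℝ}

/-- The dual of a `p`-convex Banach space is `s`-smooth, `s` the conjugate exponent, at each pair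
`x`, `z ∈ J_p x`. This is conjugate duality: at a point `u` with `w ∈ J_p u` the lower bound for
the Bregman distance of `E` leaves `(w - z) (u - x) - c ‖u - x‖ ^ p`, to which Young's inequality
applies. -/
theorem exists_dual_smoothness [CompleteSpace E] (hp : 2 ≤ p) (hps : p.HolderConjugate s)
    (hE : IsPConvex E p) :
    ∃ C : ℝ, 0 < C ∧ ∀ (x : E) (z w : StrongDual ℝ E), z ∈ dualityMap p x →
      1 / p * ‖x‖ ^ p + 1 / s * ‖w‖ ^ s - w x ≤ C * ‖w - z‖ ^ s := by
  obtain ⟨c, hc, hD⟩ := exists_mul_rpow_norm_sub_le hp hps hE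
  have hp0 : 0 < p := hps.pos
  have hs0 : 0 < s := hps.symm.pos
  -- `σ ^ p / p = c`
  set σ := (p * c) ^ (1 / p) with hσ
  have hσ0 : 0 < σ := by positivity
  have hσp : σ ^ p = p * c := by
    rw [hσ, ← Real.rpow_mul (by positivity), one_div, inv_mul_cancel₀ hp0.ne', Real.rpow_one]
  refine ⟨(σ⁻¹) ^ s / s, by positivity, fun x z w hz => ?_⟩
  obtain ⟨u, hu⟩ := exists_mem_dualityMap hp hps hE w
  have h1 := hD x u z hz
  have hzx := dualityMap_apply_self hps hz
  have hwu := dualityMap_apply_self hps hu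
  have hwn := dualityMap_norm_rpow hps hu
  have hs : 1 / s = 1 - 1 / p := by
    have := hps.inv_add_inv_eq_one
    simp only [one_div]; linarith
  have h2 : (w - z) (u - x) ≤ ‖w - z‖ * ‖u - x‖ := (le_abs_self _).trans ((w - z).le_opNorm _)
  have h3 := Real.young_inequality_of_nonneg (a := σ⁻¹ * ‖w - z‖) (b := σ * ‖u - x‖)
    (by positivity) (by positivity) hps.symm
  have e1 : σ⁻¹ * ‖w - z‖ * (σ * ‖u - x‖) = ‖w - z‖ * ‖u - x‖ := by field_simp
  have e2 : (σ * ‖u - x‖) ^ p / p = c * ‖u - x‖ ^ p := by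
    rw [Real.mul_rpow hσ0.le (norm_nonneg _), hσp]; field_simp
  have e3 : (σ⁻¹ * ‖w - z‖) ^ s / s = σ⁻¹ ^ s / s * ‖w - z‖ ^ s := by
    rw [Real.mul_rpow (by positivity) (norm_nonneg _)]; ring
  rw [e1, e2, e3] at h3
  simp only [sub_apply, map_sub] at h2
  rw [hwn]
  rw [hs] at h1 ⊢
  linarith

/-- In the dual of a `p`-convex Banach space the duality map `J_s` is single-valued: a subgradient
of `‖·‖ ^ s / s` at `ξ` is dominated by the derivative of that function, which is evaluation at
the point `x` with `ξ ∈ J_p x`. -/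
theorem eq_inclusionInDoubleDual [CompleteSpace E] (hp : 2 ≤ p) (hps : p.HolderConjugate s)
    (hE : IsPConvex E p) {x : E} {ξ : StrongDual ℝ E} (hξ : ξ ∈ dualityMap p x)
    {Φ : StrongDual ℝ (StrongDual ℝ E)} (hΦ : Φ ∈ dualityMap s ξ) :
    Φ = NormedSpace.inclusionInDoubleDual ℝ E x := by
  obtain ⟨C, hC, hsm⟩ := exists_dual_smoothness hp hps hE
  have hs1 : 0 < s - 1 := by linarith [hps.symm.lt]
  have h1 : ∀ h : StrongDual ℝ E, Φ h ≤ h x + C * ‖h‖ ^ s := by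
    intro h
    have a1 := hsm x ξ (ξ + h) hξ
    have a2 : Φ (ξ + h) ≤ ‖Φ‖ ^ p / p + ‖ξ + h‖ ^ s / s :=
      ((le_abs_self _).trans (Φ.le_opNorm _)).trans
        (Real.young_inequality_of_nonneg (norm_nonneg _) (norm_nonneg _) hps)
    rw [dualityMap_norm_rpow hps.symm hΦ, map_add, dualityMap_apply_self hps.symm hΦ,
      dualityMap_norm_rpow hps hξ] at a2
    rw [add_apply, dualityMap_apply_self hps hξ, add_sub_cancel_left] at a1
    have e1 : ‖x‖ ^ p / p = 1 / p * ‖x‖ ^ p := by ring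
    have e2 : ‖ξ + h‖ ^ s / s = 1 / s * ‖ξ + h‖ ^ s := by ring
    rw [e1, e2] at a2
    linarith
  -- replacing `h` by `t h` and letting `t → 0` removes the error term
  have h2 : ∀ h : StrongDual ℝ E, Φ h ≤ h x := by
    intro h
    have hlim : Tendsto (fun t : ℝ => h x + C * (t ^ (s - 1) * ‖h‖ ^ s)) (𝓝[>] 0) (𝓝 (h x)) := by
      have : Tendsto (fun t : ℝ => t ^ (s - 1)) (𝓝[>] 0) (𝓝 0) := by
        have := (Real.continuousAt_rpow_const 0 (s - 1) (Or.inr hs1.le)).tendsto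
        rw [Real.zero_rpow hs1.ne'] at this
        exact this.mono_left nhdsWithin_le_nhds
      simpa using ((this.mul_const (‖h‖ ^ s)).const_mul C).const_add (h x)
    refine ge_of_tendsto hlim ?_
    filter_upwards [self_mem_nhdsWithin] with t ht
    have ht0 : 0 < t := ht
    have := h1 (t • h)
    rw [map_smul, smul_eq_mul, smul_apply, smul_eq_mul, norm_smul, Real.norm_of_nonneg ht0.le,
      Real.mul_rpow ht0.le (norm_nonneg _)] at this
    refine le_of_mul_le_mul_left ?_ ht0
    calc t * Φ h ≤ _ := this
      _ = t * (h x + C * (t ^ (s - 1) * ‖h‖ ^ s)) := by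
        rw [Real.rpow_sub_one ht0.ne']; field_simp
  ext h
  rw [NormedSpace.dual_def]
  refine le_antisymm (h2 h) ?_
  have := h2 (-h)
  rw [map_neg, neg_apply] at this
  linarith

theorem dualityFun_dual_apply [CompleteSpace E] (hp : 2 ≤ p) (hps : p.HolderConjugate s)
    (hE : IsPConvex E p) {x : E} {ξ : StrongDual ℝ E} (hξ : ξ ∈ dualityMap p x)
    (η : StrongDual ℝ E) : dualityFun s ξ η = η x := by
  rw [eq_inclusionInDoubleDual hp hps hE hξ (dualityFun_mem hps.symm.lt ξ), NormedSpace.dual_def]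

theorem bregman_dual_eq [CompleteSpace E] (hp : 2 ≤ p) (hps : p.HolderConjugate s)
    (hE : IsPConvex E p) {x : E} {ξ : StrongDual ℝ E} (hξ : ξ ∈ dualityMap p x)
    (η : StrongDual ℝ E) :
    bregman s ξ η = 1 / p * ‖x‖ ^ p + 1 / s * ‖η‖ ^ s - η x := by
  rw [bregman, dualityFun_dual_apply hp hps hE hξ, dualityMap_norm_rpow hps hξ,
    hps.symm.conjExponent_eq]

theorem exists_isDualSmoothnessConst [CompleteSpace E] (hp : 2 ≤ p) (hE : IsPConvex E p) :
    ∃ G : ℝ, IsDualSmoothnessConst E p G := by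
  have hps : p.HolderConjugate p.conjExponent := .conjExponent (by linarith)
  obtain ⟨C, hC, hsm⟩ := exists_dual_smoothness hp hps hE
  have hs0 := hps.symm.pos
  refine ⟨p.conjExponent * C, by positivity, fun z w => ?_⟩
  obtain ⟨x, hx⟩ := exists_mem_dualityMap hp hps hE z
  rw [bregman_dual_eq hp hps hE hx]
  refine (hsm x z w hx).trans (le_of_eq ?_)
  field_simp

theorem mem_dualityMap_dualDualityFun [CompleteSpace E] (hp : 2 ≤ p) (hE : IsPConvex E p)
    (ξ : StrongDual ℝ E) : ξ ∈ dualityMap p (dualDualityFun p ξ) := by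
  have hps : p.HolderConjugate p.conjExponent := .conjExponent (by linarith)
  obtain ⟨x, hx⟩ := exists_mem_dualityMap hp hps hE ξ
  rw [← inclusionInDoubleDual_mem_dualityMap_iff hps]
  exact Classical.epsilon_spec (p := fun x : E =>
    NormedSpace.inclusionInDoubleDual ℝ E x ∈ dualityMap p.conjExponent ξ)
    ⟨x, (inclusionInDoubleDual_mem_dualityMap_iff hps).2 hx⟩

theorem dualityFun_dualDualityFun [CompleteSpace E] (hp : 2 ≤ p) (hE : IsPConvex E p)
    (hsm : IsSmoothSpace E) (ξ : StrongDual ℝ E) : dualityFun p (dualDualityFun p ξ) = ξ :=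
  dualityFun_eq hsm (by linarith) (mem_dualityMap_dualDualityFun hp hE ξ)

/-- The points `x` and `x'` coincide if `J_p x` and `J_p x'` have a common element, since their
Bregman distance vanishes. -/
theorem dualityMap_injective (hp : 2 ≤ p) (hE : IsPConvex E p) {x x' : E} {ξ : StrongDual ℝ E}
    (hx : ξ ∈ dualityMap p x) (hx' : ξ ∈ dualityMap p x') : x = x' := by
  have hps : p.HolderConjugate p.conjExponent := .conjExponent (by linarith)
  obtain ⟨c, hc, hD⟩ := exists_mul_rpow_norm_sub_le hp hps hE
  have h1 := hD x' x ξ hx'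
  rw [dualityMap_apply_self hps hx, ← dualityMap_norm_rpow hps hx,
    ← dualityMap_norm_rpow hps hx'] at h1
  have h2 : 1 / p.conjExponent * ‖ξ‖ ^ p.conjExponent + 1 / p * ‖ξ‖ ^ p.conjExponent
      = ‖ξ‖ ^ p.conjExponent := by
    rw [← add_mul, one_div, one_div, add_comm, hps.inv_add_inv_eq_one, one_mul]
  rw [h2, sub_self] at h1
  by_contra hne
  have : 0 < ‖x - x'‖ := norm_pos_iff.2 (sub_ne_zero.2 hne)
  have : 0 < c * ‖x - x'‖ ^ p := by positivity
  linarith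

end DualSmoothness

/-! ### Real sequences -/

/-- A sequence bounded below that decreases up to summable errors converges. -/
theorem exists_tendsto_of_le_add_summable {a ν : ℕ → ℝ} {b : ℝ} (hb : ∀ k, b ≤ a k)
    (hν : Summable ν) (hν0 : ∀ k, 0 ≤ ν k) (h : ∀ k, a (k + 1) ≤ a k + ν k) :
    ∃ l, Tendsto a atTop (𝓝 l) := by
  have hanti : Antitone fun k => a k - ∑ j ∈ Finset.range k, ν j := by
    refine antitone_nat_of_succ_le fun k => ?_
    rw [Finset.sum_range_succ]
    linarith [h k]
  have hbdd : BddBelow (Set.range fun k => a k - ∑ j ∈ Finset.range k, ν j) := by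
    refine ⟨b - ∑' j, ν j, ?_⟩
    rintro _ ⟨k, rfl⟩
    have := hν.sum_le_tsum (Finset.range k) fun j _ => hν0 j
    simp only
    linarith [hb k]
  have h1 := tendsto_atTop_ciInf hanti hbdd
  have h2 := h1.add hν.hasSum.tendsto_sum_nat
  exact ⟨_, by simpa using h2⟩

theorem add_sum_le_of_le_sub_add {a d ν : ℕ → ℝ} (hν : Summable ν) (hν0 : ∀ k, 0 ≤ ν k)
    (h : ∀ k, a (k + 1) ≤ a k - d k + ν k) (n : ℕ) :
    a n + ∑ k ∈ Finset.range n, d k ≤ a 0 + ∑' k, ν k := by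
  have h1 : a n + ∑ k ∈ Finset.range n, d k ≤ a 0 + ∑ k ∈ Finset.range n, ν k := by
    induction n with
    | zero => simp
    | succ n ih =>
      rw [Finset.sum_range_succ, Finset.sum_range_succ]
      linarith [h n]
  linarith [hν.sum_le_tsum (Finset.range n) fun j _ => hν0 j]

/-- A positive sequence with infimum `0` has infinitely many running minima. -/
theorem frequently_forall_le_of_pos {φ : ℕ → ℝ} (hpos : ∀ n, 0 < φ n)
    (hinf : ∀ ε > 0, ∃ n, φ n < ε) : ∃ᶠ n in atTop, ∀ k ≤ n, φ n ≤ φ k := by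
  rw [frequently_atTop]
  intro M
  obtain ⟨k₀, -, hk₀⟩ := Finset.exists_min_image (Finset.range (M + 1)) φ ⟨0, by simp⟩
  classical
  have hex := hinf (φ k₀) (hpos k₀)
  refine ⟨Nat.find hex, ?_, fun k hk => ?_⟩
  · by_contra! hlt
    exact absurd (Nat.find_spec hex) (not_lt.2 (hk₀ _ (Finset.mem_range.2 (by lia))))
  · rcases hk.eq_or_lt with rfl | hlt
    · exact le_rfl
    · exact (Nat.find_spec hex).le.trans (not_lt.1 (Nat.find_min hex hlt))

theorem exists_lt_of_summable_mul {m φ : ℕ → ℝ} (hm : ∀ k, 0 ≤ m k) (hsum : ¬ Summable m)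
    (hφ : Summable fun k => m k * φ k) {ε : ℝ} (hε : 0 < ε) : ∃ n, φ n < ε := by
  by_contra! h
  refine hsum (Summable.of_nonneg_of_le hm (fun k => ?_) (hφ.mul_left ε⁻¹))
  have := mul_le_mul_of_nonneg_left (h k) (hm k)
  calc m k = ε⁻¹ * (m k * ε) := by field_simp
    _ ≤ _ := by gcongr

/-! ### The Bregman distance along the iteration -/

section Bregman

variable {X : Type*} [NormedAddCommGroup X] [NormedSpace ℝ X] {p : ℝ}

theorem bregman_self (hp : 1 < p) (x : X) : bregman p x x = 0 := by
  have hps : p.HolderConjugate p.conjExponent := .conjExponent hp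
  rw [bregman, dualityMap_apply_self hps (dualityFun_mem hp x), ← add_mul, one_div, one_div,
    add_comm, hps.inv_add_inv_eq_one, one_mul, sub_self]

/-- The three-point identity of the Bregman distance. -/
theorem bregman_three_point (hp : 1 < p) (x z v : X) :
    bregman p x z = bregman p x v - bregman p z v
      + (dualityFun p z - dualityFun p x) (z - v) := by
  have h := bregman_self hp z
  simp only [bregman, sub_apply, map_sub] at h ⊢
  linarith

theorem bregman_tendsto_zero (hp : 1 < p) {ι : Type*} {l : Filter ι} {x : ι → X} {z : X}
    (hx : Tendsto x l (𝓝 z)) : Tendsto (fun k => bregman p (x k) z) l (𝓝 0) := by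
  have hnorm := hx.norm
  have h1 : Tendsto (fun k => dualityFun p (x k) (x k - z)) l (𝓝 0) := by
    have hb : Tendsto (fun k => ‖x k‖ ^ (p - 1) * ‖x k - z‖) l (𝓝 0) := by
      have := (hnorm.rpow_const (p := p - 1) (Or.inr (by linarith))).mul
        (tendsto_iff_norm_sub_tendsto_zero.1 hx)
      simpa using this
    refine squeeze_zero_norm (fun k => ?_) hb
    rw [← (dualityFun_mem hp (x k)).2]
    exact (dualityFun p (x k)).le_opNorm _
  have h2 : Tendsto (fun k => 1 / p * (‖z‖ ^ p - ‖x k‖ ^ p)) l (𝓝 0) := by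
    have := ((hnorm.rpow_const (p := p) (Or.inr (by linarith))).const_sub (‖z‖ ^ p)).const_mul
      (1 / p)
    simpa using this
  have h3 := h2.add h1
  rw [add_zero] at h3
  refine h3.congr fun k => ?_
  have := bregman_self hp (x k)
  simp only [bregman, map_sub] at this ⊢
  linarith

/-- The descent estimate of a single step. The admissible constant bounds the Bregman distance in
the dual space of `J_p x` and `J_p x'`, whose difference is `m • T* j`; the resulting power
`R ^ ((q - 1) p*)` of the residual `R = ‖T x - b‖` is at most `1 + R ^ q`, because `q ≤ p`. -/
theorem bregman_step_le [CompleteSpace X] (hp : 2 ≤ p) (hX : IsPConvex X p)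
    {Z : Type*} [NormedAddCommGroup Z] [NormedSpace ℝ Z] {T : X →L[ℝ] Z} {b : Z} {q : ℝ}
    (hq1 : 1 < q) (hqp : q ≤ p) {x x' v : X} {j : StrongDual ℝ Z} (hj : j ∈ dualityMap q (T x - b))
    {m G L : ℝ} (hm : 0 < m) (hG : IsDualSmoothnessConst X p G) (hT : ‖T‖ ≤ L)
    (hx' : dualityFun p x' = dualityFun p x - m • j.comp T) (hv : T v = b) :
    bregman p x' v ≤ bregman p x v
      - m * (1 - m ^ (p.conjExponent - 1) * (G * L ^ p.conjExponent) / p.conjExponent)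
        * ‖T x - b‖ ^ q
      + 1 / p.conjExponent * G * L ^ p.conjExponent * m ^ p.conjExponent := by
  have hp1 : 1 < p := by linarith
  have hps : p.HolderConjugate p.conjExponent := .conjExponent hp1
  set s := p.conjExponent with hs
  have hs0 : 0 < s := hps.symm.pos
  have hqc : q.HolderConjugate q.conjExponent := .conjExponent hq1
  have hG0 := hG.1
  have hL0 : 0 ≤ L := (norm_nonneg _).trans hT
  have h1 := hG.2 (dualityFun p x) (dualityFun p x')
  rw [← hs, bregman_dual_eq hp hps hX (dualityFun_mem hp1 x)] at h1
  set R := ‖T x - b‖ with hR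
  have hR0 : 0 ≤ R := norm_nonneg _
  have hnx' := dualityMap_norm_rpow hps (dualityFun_mem hp1 x')
  have hself := dualityMap_apply_self hps (dualityFun_mem hp1 x)
  have hjR : j (T x) - j b = R ^ q := by
    rw [← map_sub, dualityMap_apply_self hqc hj]
  have hnorm : ‖dualityFun p x' - dualityFun p x‖ ^ s ≤ m ^ s * (L ^ s * (1 + R ^ q)) := by
    have e : dualityFun p x' - dualityFun p x = -(m • j.comp T) := by rw [hx']; abel
    have hle : ‖dualityFun p x' - dualityFun p x‖ ≤ m * (L * R ^ (q - 1)) := by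
      rw [e, norm_neg, norm_smul, Real.norm_of_nonneg hm.le]
      gcongr
      refine (ContinuousLinearMap.opNorm_comp_le _ _).trans ?_
      rw [hj.2, mul_comm]
      gcongr
    refine (Real.rpow_le_rpow (norm_nonneg _) hle hs0.le).trans ?_
    rw [Real.mul_rpow hm.le (by positivity), Real.mul_rpow hL0 (by positivity),
      ← Real.rpow_mul hR0]
    gcongr
    have hexp : (q - 1) * s ≤ q := by
      have h2 : (p - 1) * s = p := hps.sub_one_mul_conj
      have h3 : 0 < p - 1 := by linarith
      have h4 : (p - 1) * ((q - 1) * s) ≤ (p - 1) * q := by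
        have : (p - 1) * ((q - 1) * s) = (q - 1) * ((p - 1) * s) := by ring
        rw [this, h2]
        linarith
      exact le_of_mul_le_mul_left h4 h3
    rcases le_total R 1 with h | h
    · have := Real.rpow_le_one hR0 h (z := (q - 1) * s) (mul_nonneg (by linarith) hs0.le)
      linarith [Real.rpow_nonneg hR0 q]
    · linarith [Real.rpow_le_rpow_of_exponent_le h hexp]
  have h2 := mul_le_mul_of_nonneg_left hnorm (by positivity : 0 ≤ 1 / s * G)
  have hx'x : dualityFun p x' x = ‖x‖ ^ p - m * j (T x) := by
    rw [hx']; simp [hself]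
  have hx'v : dualityFun p x' v = dualityFun p x v - m * j b := by
    rw [hx']; simp [hv]
  have hpow : m ^ s = m * m ^ (s - 1) := by
    rw [Real.rpow_sub_one hm.ne']; field_simp
  have e1 : 1 / s * G * (m ^ s * (L ^ s * (1 + R ^ q)))
      = m * (m ^ (s - 1) * (G * L ^ s) / s) * R ^ q + 1 / s * G * L ^ s * m ^ s := by
    rw [hpow]; field_simp; ring
  have hsp : 1 / s = 1 - 1 / p := by
    have := hps.inv_add_inv_eq_one
    simp only [one_div]; linarith
  have h3 : (1 / s) * ‖x'‖ ^ p ≤ (1 / s) * ‖x‖ ^ p - m * R ^ q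
      + (m * (m ^ (s - 1) * (G * L ^ s) / s) * R ^ q + 1 / s * G * L ^ s * m ^ s)
      + m * (- j b) := by
    rw [← e1]
    rw [hx'x, hnx'] at h1
    have : m * R ^ q = m * j (T x) - m * j b := by rw [← hjR]; ring
    have e2 : (1 / s) * ‖x‖ ^ p = ‖x‖ ^ p - 1 / p * ‖x‖ ^ p := by rw [hsp]; ring
    linarith
  rw [bregman, bregman, hx'v, ← hs]
  linarith

end Bregman

/-! ### Convergence of a single path -/

section Path

variable {X : Type*} [NormedAddCommGroup X] [NormedSpace ℝ X] {p : ℝ}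
  {N : ℕ} {Y : Fin N → Type*} [∀ j, NormedAddCommGroup (Y j)] [∀ j, NormedSpace ℝ (Y j)]

/-- The sum `∑ j, ‖A_j x - y_j‖ ^ q` of the powers of all residuals of `x`. -/
noncomputable def totalResidual (q : ℝ) (A : ∀ j, X →L[ℝ] Y j) (y : ∀ j, Y j) (x : X) : ℝ :=
  ∑ j, ‖A j x - y j‖ ^ q

/-- `x` is a sequence of Kaczmarz iterates along the index sequence `idx`. The step is recorded in
the dual space, where it is a subtraction. -/
def IsKaczmarzSeq (p : ℝ) (A : ∀ j, X →L[ℝ] Y j) (y : ∀ j, Y j)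
    (jY : ∀ j, Y j → StrongDual ℝ (Y j)) (μ : ℕ → ℝ) (idx : ℕ → Fin N) (x : ℕ → X) : Prop :=
  ∀ k, dualityFun p (x (k + 1)) = dualityFun p (x k) - μ (k + 1) •
    (jY (idx (k + 1)) (A (idx (k + 1)) (x k) - y (idx (k + 1)))).comp (A (idx (k + 1)))

variable {A : ∀ j, X →L[ℝ] Y j} {y : ∀ j, Y j} {jY : ∀ j, Y j → StrongDual ℝ (Y j)}
  {μ : ℕ → ℝ} {idx : ℕ → Fin N} {x : ℕ → X} {q : ℝ}

theorem isKaczmarzSeq_iterates [CompleteSpace X] (hp : 2 ≤ p) (hX : IsPConvex X p)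
    (hsm : IsSmoothSpace X) (x₀ : X) :
    IsKaczmarzSeq p A y jY μ idx (iterates p A y jY μ x₀ idx) := fun k => by
  rw [iterates]
  exact dualityFun_dualDualityFun hp hX hsm _

theorem totalResidual_nonneg (z : X) : 0 ≤ totalResidual q A y z :=
  Finset.sum_nonneg fun _ _ => Real.rpow_nonneg (norm_nonneg _) _

theorem rpow_residual_le (z : X) (j : Fin N) : ‖A j z - y j‖ ^ q ≤ totalResidual q A y z :=
  Finset.single_le_sum (f := fun j => ‖A j z - y j‖ ^ q)
    (fun _ _ => Real.rpow_nonneg (norm_nonneg _) _) (Finset.mem_univ j)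

theorem solution_of_totalResidual_eq_zero (hq : 0 < q) {z : X}
    (h : totalResidual q A y z = 0) (j : Fin N) : A j z = y j := by
  have h1 : ‖A j z - y j‖ ^ q = 0 :=
    le_antisymm (h ▸ rpow_residual_le z j) (Real.rpow_nonneg (norm_nonneg _) _)
  rw [Real.rpow_eq_zero (norm_nonneg _) hq.ne', norm_eq_zero, sub_eq_zero] at h1
  exact h1

theorem continuous_totalResidual (hq : 0 < q) : Continuous (totalResidual q A y) := by
  unfold totalResidual
  refine continuous_finsetSum _ fun j _ => ?_
  exact (((A j).continuous.sub continuous_const).norm).rpow_const fun _ => Or.inr hq.le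

/-- Once a solution is reached the iteration stays there. -/
theorem IsKaczmarzSeq.eq_of_totalResidual_eq_zero (hx : IsKaczmarzSeq p A y jY μ idx x)
    (hp : 2 ≤ p) (hX : IsPConvex X p) (hq : 1 < q) (hjY : ∀ j v, jY j v ∈ dualityMap q v)
    {n : ℕ} (hn : totalResidual q A y (x n) = 0) {k : ℕ} (hk : n ≤ k) : x k = x n := by
  induction k, hk using Nat.le_induction with
  | base => rfl
  | succ k hk ih =>
    rw [← ih] at hn ⊢
    have hsol := solution_of_totalResidual_eq_zero (by linarith) hn (idx (k + 1))
    have hj := hjY (idx (k + 1)) (A (idx (k + 1)) (x k) - y (idx (k + 1)))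
    rw [hsol, sub_self] at hj
    have hj0 : jY (idx (k + 1)) 0 = 0 := by
      have := hj.2
      rw [norm_zero, Real.zero_rpow (by linarith)] at this
      exact norm_eq_zero.1 this
    have h1 := hx k
    rw [hsol, sub_self, hj0, ContinuousLinearMap.zero_comp, smul_zero, sub_zero] at h1
    exact dualityMap_injective hp hX (h1 ▸ dualityFun_mem (by linarith) _)
      (dualityFun_mem (by linarith) _)

/-- The cross term of the three-point identity between the steps `m ≤ n`, when the total residual
at `n` is a running minimum. -/
theorem IsKaczmarzSeq.cross_term_le (hx : IsKaczmarzSeq p A y jY μ idx x) (hq : 1 < q)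
    (hjY : ∀ j v, jY j v ∈ dualityMap q v) (hμ : ∀ k, 0 < μ (k + 1)) {v : X}
    (hv : ∀ j, A j v = y j) {n : ℕ}
    (hn : ∀ k ≤ n, totalResidual q A y (x n) ≤ totalResidual q A y (x k))
    {m : ℕ} {k : ℕ} (hmk : m ≤ k) (hkn : k ≤ n) :
    (dualityFun p (x k) - dualityFun p (x m)) (x n - v) ≤
      ∑ l ∈ Finset.range k, μ (l + 1) * totalResidual q A y (x l)
        - ∑ l ∈ Finset.range m, μ (l + 1) * totalResidual q A y (x l) := by
  induction k, hmk using Nat.le_induction with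
  | base => simp
  | succ k hmk ih =>
    have h1 := ih (by omega)
    rw [Finset.sum_range_succ]
    set i := idx (k + 1) with hi
    have hstep : (dualityFun p (x (k + 1)) - dualityFun p (x m)) (x n - v)
        = (dualityFun p (x k) - dualityFun p (x m)) (x n - v)
          - μ (k + 1) * jY i (A i (x k) - y i) (A i (x n) - y i) := by
      rw [hx k, ← hi]
      simp only [sub_apply, smul_apply, smul_eq_mul,
        ContinuousLinearMap.comp_apply, map_sub, hv]
      ring
    have hterm : -(jY i (A i (x k) - y i) (A i (x n) - y i)) ≤ totalResidual q A y (x k) := by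
      set R := ‖A i (x k) - y i‖ with hR
      set t := ‖A i (x n) - y i‖ with ht
      have h2 : -(jY i (A i (x k) - y i) (A i (x n) - y i)) ≤ R ^ (q - 1) * t := by
        refine (neg_le_abs _).trans
          (((jY i (A i (x k) - y i)).le_opNorm (A i (x n) - y i)).trans ?_)
        rw [(hjY i _).2]
      have hM0 : 0 ≤ max R t := le_max_of_le_left (norm_nonneg _)
      have h3 : R ^ (q - 1) * t ≤ max R t ^ q := by
        have : max R t ^ q = max R t ^ (q - 1) * max R t := by
          rw [← Real.rpow_add_one' hM0 (by linarith)]; congr 1; ring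
        rw [this]
        exact mul_le_mul (Real.rpow_le_rpow (norm_nonneg _) (le_max_left _ _) (by linarith))
          (le_max_right _ _) (norm_nonneg _) (Real.rpow_nonneg hM0 _)
      refine (h2.trans h3).trans ?_
      rcases max_choice R t with h | h <;> rw [h]
      · exact rpow_residual_le _ _
      · exact (rpow_residual_le _ _).trans (hn k (by omega))
    have h4 := mul_le_mul_of_nonneg_left hterm (hμ k).le
    rw [hstep]
    linarith

/-- If the weighted total residuals are summable and the Bregman distance to every solution
converges, then the iterates converge to a solution. Along the running minima of the total
residual the iterates are Cauchy, and their limit is a solution `z`; the Bregman distance to `z`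
converges along the whole sequence, and vanishes along the subsequence. -/
theorem IsKaczmarzSeq.exists_tendsto [CompleteSpace X] (hx : IsKaczmarzSeq p A y jY μ idx x)
    (hp : 2 ≤ p) (hX : IsPConvex X p) (hq : 1 < q) (hjY : ∀ j v, jY j v ∈ dualityMap q v)
    (hμ : ∀ k, 0 < μ (k + 1)) (hμ_sum : ¬ Summable fun k => μ (k + 1))
    (hsol : ∃ v, ∀ j, A j v = y j)
    (hconv : ∀ v, (∀ j, A j v = y j) → ∃ l, Tendsto (fun k => bregman p (x k) v) atTop (𝓝 l))
    (hres : Summable fun k => μ (k + 1) * totalResidual q A y (x k)) :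
    ∃ z, (∀ j, A j z = y j) ∧ Tendsto x atTop (𝓝 z) ∧
      Tendsto (fun k => bregman p (x k) z) atTop (𝓝 0) := by
  have hp1 : 1 < p := by linarith
  have hps : p.HolderConjugate p.conjExponent := .conjExponent hp1
  by_cases hz : ∃ n, totalResidual q A y (x n) = 0
  · obtain ⟨n, hn⟩ := hz
    have hev : ∀ᶠ k in atTop, x n = x k := by
      filter_upwards [eventually_ge_atTop n] with k hk
      exact (hx.eq_of_totalResidual_eq_zero hp hX hq hjY hn hk).symm
    have hlim : Tendsto x atTop (𝓝 (x n)) := tendsto_const_nhds.congr' hev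
    exact ⟨x n, solution_of_totalResidual_eq_zero (by linarith) hn, hlim,
      bregman_tendsto_zero hp1 hlim⟩
  push Not at hz
  obtain ⟨c, hc, hD⟩ := exists_mul_rpow_norm_sub_le hp hps hX
  have hinf : ∀ ε > 0, ∃ n, totalResidual q A y (x n) < ε := fun ε hε =>
    exists_lt_of_summable_mul (fun k => (hμ k).le) hμ_sum hres hε
  obtain ⟨θ, hθ, hrec⟩ := extraction_of_frequently_atTop (frequently_forall_le_of_pos
    (fun n => lt_of_le_of_ne (totalResidual_nonneg (x n)) (hz n).symm) hinf)
  obtain ⟨v, hv⟩ := hsol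
  obtain ⟨l, hl⟩ := hconv v hv
  -- `c ‖x n - x m‖ ^ p ≤ H m - H n` for running minima `m ≤ n`, and `H` converges
  set H : ℕ → ℝ := fun k => bregman p (x k) v
    - ∑ l ∈ Finset.range k, μ (l + 1) * totalResidual q A y (x l) with hH
  have hHc : CauchySeq (H ∘ θ) :=
    ((hl.sub hres.hasSum.tendsto_sum_nat).comp hθ.tendsto_atTop).cauchySeq
  have hle : ∀ a b, a ≤ b → c * ‖x (θ b) - x (θ a)‖ ^ p ≤ H (θ a) - H (θ b) := by
    intro a b hab
    refine (hD _ _ _ (dualityFun_mem hp1 _)).trans ?_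
    have h1 := bregman_three_point hp1 (x (θ a)) (x (θ b)) v
    have h2 := hx.cross_term_le hq hjY hμ hv (hrec b) (hθ.monotone hab) le_rfl
    rw [bregman] at h1
    rw [h1, hH]
    simp only
    linarith
  have hxc : CauchySeq (x ∘ θ) := by
    rw [Metric.cauchySeq_iff'] at hHc ⊢
    intro ε hε
    obtain ⟨M, hM⟩ := hHc (c * ε ^ p) (by positivity)
    refine ⟨M, fun n hn => ?_⟩
    have h1 := hM n hn
    rw [Real.dist_eq, abs_sub_comm] at h1
    have h2 := (hle M n hn).trans_lt ((le_abs_self _).trans_lt h1)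
    rw [dist_eq_norm]
    exact (Real.rpow_lt_rpow_iff (norm_nonneg _) hε.le (by linarith)).1
      (lt_of_mul_lt_mul_left h2 hc.le)
  obtain ⟨z, hz'⟩ := cauchySeq_tendsto_of_complete hxc
  have hzres : totalResidual q A y z = 0 := by
    refine le_antisymm (le_of_forall_pos_le_add fun ε hε => ?_) (totalResidual_nonneg z)
    obtain ⟨m, hm⟩ := hinf ε hε
    have h1 : Tendsto (fun k => totalResidual q A y (x (θ k))) atTop
        (𝓝 (totalResidual q A y z)) :=
      ((continuous_totalResidual (by linarith)).tendsto z).comp hz'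
    refine le_of_tendsto h1 ?_
    filter_upwards [hθ.tendsto_atTop.eventually_ge_atTop m] with k hk
    linarith [hrec k m hk]
  have hzsol := solution_of_totalResidual_eq_zero (by linarith) hzres
  obtain ⟨l', hl'⟩ := hconv z hzsol
  have hl0 : l' = 0 := tendsto_nhds_unique (hl'.comp hθ.tendsto_atTop)
    (bregman_tendsto_zero hp1 hz')
  rw [hl0] at hl'
  refine ⟨z, hzsol, ?_, hl'⟩
  rw [Metric.tendsto_nhds]
  intro ε hε
  filter_upwards [hl'.eventually_lt_const (by positivity : 0 < c * ε ^ p)] with k hk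
  have h1 := (hD _ z _ (dualityFun_mem hp1 (x k))).trans_lt hk
  rw [dist_comm, dist_eq_norm]
  exact (Real.rpow_lt_rpow_iff (norm_nonneg _) hε.le (by linarith)).1
    (lt_of_mul_lt_mul_left h1 hc.le)

/-- Functionals in the closure of the range of the adjoint annihilate the kernel. -/
theorem apply_eq_of_mem_closure_adjointRange {Z : Type*} [NormedAddCommGroup Z] [NormedSpace ℝ Z]
    {T : X →L[ℝ] Z} {ξ : StrongDual ℝ X} (hξ : ξ ∈ closure (adjointRange T)) {z z' : X}
    (h : T z = T z') : ξ z = ξ z' := by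
  have hc : IsClosed {ξ : StrongDual ℝ X | ξ z = ξ z'} :=
    isClosed_eq (ContinuousLinearMap.apply ℝ ℝ z).continuous
      (ContinuousLinearMap.apply ℝ ℝ z').continuous
  refine closure_minimal ?_ hc hξ
  rintro _ ⟨η, rfl⟩
  simp [h]

theorem IsKaczmarzSeq.apply_eq (hx : IsKaczmarzSeq p A y jY μ idx x) {r : ℝ≥0∞} [Fact (1 ≤ r)]
    (h0 : dualityFun p (x 0) ∈ closure (adjointRange (stack r A))) {z z' : X}
    (h : stack r A z = stack r A z') (k : ℕ) : dualityFun p (x k) z = dualityFun p (x k) z' := by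
  induction k with
  | zero => exact apply_eq_of_mem_closure_adjointRange h0 h
  | succ k ih =>
    have hj : A (idx (k + 1)) z = A (idx (k + 1)) z' := congrArg (fun w => w (idx (k + 1))) h
    rw [hx k]
    simp [ih, hj]

/-- The Bregman distance to a minimum norm solution `v` is at most the one to any other
solution `z`, because `J_p (x k)` takes the same value at both. -/
theorem IsKaczmarzSeq.bregman_le (hx : IsKaczmarzSeq p A y jY μ idx x) (hp : 0 < p)
    {r : ℝ≥0∞} [Fact (1 ≤ r)]
    (h0 : dualityFun p (x 0) ∈ closure (adjointRange (stack r A))) {b : PiLp r Y} {v z : X}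
    (hv : IsMinNormSolution (stack r A) b v) (hz : stack r A z = b) (k : ℕ) :
    bregman p (x k) v ≤ bregman p (x k) z := by
  have h1 : ‖v‖ ≤ ‖z‖ := by
    rw [hv.2]
    refine csInf_le ⟨0, ?_⟩ ⟨z, hz, rfl⟩
    rintro _ ⟨w, -, rfl⟩
    exact norm_nonneg w
  rw [bregman, bregman, hx.apply_eq h0 (hv.1.trans hz.symm) k]
  have h2 := Real.rpow_le_rpow (norm_nonneg v) h1 hp.le
  gcongr

end Path

/-! ### Random indices -/

section Random

/-- The mean of `g (U, V)` over a uniform `V` independent of the discrete variable `U`. -/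
theorem lintegral_uniform_of_indepFun {Ω α : Type*} [MeasurableSpace Ω] [MeasurableSpace α]
    [DiscreteMeasurableSpace α] {P : Measure Ω} {N : ℕ} {U : Ω → α} {V : Ω → Fin N}
    (hU : Measurable U) (hV : Measurable V) (hUV : IndepFun U V P)
    (hunif : ∀ j, P {ω | V ω = j} = (N : ℝ≥0∞)⁻¹) (g : α → Fin N → ℝ≥0∞) :
    ∫⁻ ω, g (U ω) (V ω) ∂P = (N : ℝ≥0∞)⁻¹ * ∫⁻ ω, ∑ j, g (U ω) j ∂P := by
  have hgm : ∀ j, Measurable fun ω => g (U ω) j := fun j =>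
    (Measurable.of_discrete (f := fun a => g a j)).comp hU
  let χ : Fin N → Fin N → ℝ≥0∞ := fun j l => if l = j then 1 else 0
  have hχm : ∀ j, Measurable fun ω => χ j (V ω) := fun j =>
    (Measurable.of_discrete (f := χ j)).comp hV
  have h1 : ∀ ω, g (U ω) (V ω) = ∑ j, χ j (V ω) * g (U ω) j := fun ω => by
    simp [χ]
  simp only [h1]
  have hm : ∀ j, Measurable fun ω => χ j (V ω) * g (U ω) j := fun j => (hχm j).mul (hgm j)
  rw [lintegral_finsetSum _ fun j _ => hm j,
    lintegral_finsetSum _ fun j _ => hgm j, Finset.mul_sum]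
  refine Finset.sum_congr rfl fun j _ => ?_
  have hind : IndepFun (fun ω => χ j (V ω)) (fun ω => g (U ω) j) P :=
    hUV.symm.comp (φ := χ j) (ψ := fun a => g a j) .of_discrete .of_discrete
  have h2 := lintegral_mul_eq_lintegral_mul_lintegral_of_indepFun (hχm j) (hgm j) hind
  simp only [Pi.mul_apply] at h2
  rw [h2]
  congr 1
  have h3 : (fun ω => χ j (V ω)) = {ω | V ω = j}.indicator fun _ => 1 := by
    ext ω
    simp [χ, Set.indicator_apply]
  have h4 : MeasurableSet {ω | V ω = j} := hV (measurableSet_singleton j)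
  rw [h3, lintegral_indicator_const h4, one_mul, hunif]

variable {X : Type*} [NormedAddCommGroup X] [NormedSpace ℝ X] {p q : ℝ}
  {N : ℕ} {Y : Fin N → Type*} [∀ j, NormedAddCommGroup (Y j)] [∀ j, NormedSpace ℝ (Y j)]
  {A : ∀ j, X →L[ℝ] Y j} {y : ∀ j, Y j} {jY : ∀ j, Y j → StrongDual ℝ (Y j)}
  {μ : ℕ → ℝ} {x₀ : X}

theorem iterates_congr {idx idx' : ℕ → Fin N} {k : ℕ}
    (h : ∀ l < k, idx (l + 1) = idx' (l + 1)) :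
    iterates p A y jY μ x₀ idx k = iterates p A y jY μ x₀ idx' k := by
  induction k with
  | zero => rfl
  | succ k ih =>
    rw [iterates, iterates, ih fun l hl => h l (by omega), h k (by omega)]

theorem exists_iterates_eq (i₀ : Fin N) (k : ℕ) :
    ∃ F : (Finset.range k → Fin N) → X, ∀ idx : ℕ → Fin N,
      iterates p A y jY μ x₀ idx k = F fun l => idx (l + 1) := by
  classical
  refine ⟨fun t => iterates p A y jY μ x₀
    (fun n => if h : n - 1 ∈ Finset.range k then t ⟨n - 1, h⟩ else i₀) k, fun idx => ?_⟩
  refine iterates_congr fun l hl => ?_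
  have : l + 1 - 1 ∈ Finset.range k := by simpa using hl
  rw [dif_pos this]
  rfl

variable {Ω : Type*} [MeasurableSpace Ω] {P : Measure Ω} {i : ℕ → Ω → Fin N}

/-- Functions of the `k`-th iterate and the next index are measurable, since they depend only on
finitely many indices and so take finitely many values. -/
theorem measurable_comp_iterates [IsProbabilityMeasure P] (hi_meas : ∀ k, Measurable (i (k + 1)))
    {β : Type*} [MeasurableSpace β] (h : X → Fin N → β) (k : ℕ) :
    Measurable fun ω => h (iterates p A y jY μ x₀ (fun n => i n ω) k) (i (k + 1) ω) := by
  obtain ⟨ω₀⟩ := P.nonempty_of_neZero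
  obtain ⟨F, hF⟩ := exists_iterates_eq (p := p) (A := A) (y := y) (jY := jY) (μ := μ) (x₀ := x₀)
    (i 0 ω₀) k
  simp only [hF]
  have hU : Measurable fun ω => ((fun l => i (l + 1) ω : Finset.range k → Fin N), i (k + 1) ω) :=
    (measurable_pi_lambda (fun ω (l : Finset.range k) => i (l + 1) ω)
      fun l => hi_meas l).prodMk (hi_meas k)
  exact (Measurable.of_discrete
    (f := fun t : (Finset.range k → Fin N) × Fin N => h (F t.1) t.2)).comp hU

/-- In the mean of a function of the `k`-th iterate and the next index, the index may be averaged
out, as it is independent of the iterate. -/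
theorem lintegral_iterates [IsProbabilityMeasure P] (hi_meas : ∀ k, Measurable (i (k + 1)))
    (hi_unif : ∀ k j, P {ω | i (k + 1) ω = j} = (N : ℝ≥0∞)⁻¹)
    (hi_indep : iIndepFun (fun k => i (k + 1)) P) (h : X → Fin N → ℝ≥0∞) (k : ℕ) :
    ∫⁻ ω, h (iterates p A y jY μ x₀ (fun n => i n ω) k) (i (k + 1) ω) ∂P =
      (N : ℝ≥0∞)⁻¹ * ∫⁻ ω, ∑ j, h (iterates p A y jY μ x₀ (fun n => i n ω) k) j ∂P := by
  obtain ⟨ω₀⟩ := P.nonempty_of_neZero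
  obtain ⟨F, hF⟩ := exists_iterates_eq (p := p) (A := A) (y := y) (jY := jY) (μ := μ) (x₀ := x₀)
    (i 0 ω₀) k
  have hind := (hi_indep.indepFun_finset (Finset.range k) {k} (by simp) hi_meas).comp
    (φ := id) (ψ := fun t => t ⟨k, by simp⟩) measurable_id .of_discrete
  simp only [hF]
  exact lintegral_uniform_of_indepFun (U := fun ω (l : Finset.range k) => i (l + 1) ω)
    (measurable_pi_lambda _ fun l => hi_meas l) (hi_meas k) hind (hi_unif k)
    fun t j => h (F t) j

/-- A uniform bound on the sums of the weighted residuals of the chosen equations makes the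
weighted total residuals almost surely summable: both have the same mean up to a factor `N`. -/
theorem ae_summable_totalResidual [IsProbabilityMeasure P]
    (hi_meas : ∀ k, Measurable (i (k + 1)))
    (hi_unif : ∀ k j, P {ω | i (k + 1) ω = j} = (N : ℝ≥0∞)⁻¹)
    (hi_indep : iIndepFun (fun k => i (k + 1)) P) (hμ : ∀ k, 0 < μ (k + 1)) {M : ℝ}
    (hM : ∀ ω n, ∑ k ∈ Finset.range n, μ (k + 1) *
      ‖A (i (k + 1) ω) (iterates p A y jY μ x₀ (fun n => i n ω) k) - y (i (k + 1) ω)‖ ^ q ≤ M) :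
    ∀ᵐ ω ∂P, Summable fun k => μ (k + 1) *
      totalResidual q A y (iterates p A y jY μ x₀ (fun n => i n ω) k) := by
  obtain ⟨x, hx⟩ : ∃ x : ℕ → Ω → X,
      ∀ k ω, x k ω = iterates p A y jY μ x₀ (fun n => i n ω) k := ⟨_, fun _ _ => rfl⟩
  simp only [← hx] at hM ⊢
  have hmeas : ∀ (h : X → Fin N → ℝ≥0∞) k, Measurable fun ω => h (x k ω) (i (k + 1) ω) := by
    intro h k
    simp only [hx]
    exact measurable_comp_iterates (P := P) hi_meas h k
  have hlint : ∀ (h : X → Fin N → ℝ≥0∞) k, ∫⁻ ω, h (x k ω) (i (k + 1) ω) ∂P =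
      (N : ℝ≥0∞)⁻¹ * ∫⁻ ω, ∑ j, h (x k ω) j ∂P := by
    intro h k
    simp only [hx]
    exact lintegral_iterates hi_meas hi_unif hi_indep h k
  clear hx
  obtain ⟨ω₀⟩ := P.nonempty_of_neZero
  have hN : (N : ℝ≥0∞) ≠ 0 := by
    have := (i 0 ω₀).pos
    exact_mod_cast this.ne'
  have hterm : ∀ k (z : X) j, 0 ≤ μ (k + 1) * ‖A j z - y j‖ ^ q := fun k z j =>
    mul_nonneg (hμ k).le (Real.rpow_nonneg (norm_nonneg _) _)
  let g : ℕ → X → Fin N → ℝ≥0∞ := fun k z j => ENNReal.ofReal (μ (k + 1) * ‖A j z - y j‖ ^ q)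
  have hgsum : ∀ k z, ENNReal.ofReal (μ (k + 1) * totalResidual q A y z) = ∑ j, g k z j := by
    intro k z
    rw [totalResidual, Finset.mul_sum, ENNReal.ofReal_sum_of_nonneg fun j _ => hterm k _ j]
  have hmean : ∀ k, ∫⁻ ω, ∑ j, g k (x k ω) j ∂P =
      N * ∫⁻ ω, g k (x k ω) (i (k + 1) ω) ∂P := by
    intro k
    rw [hlint (g k) k, ← mul_assoc, ENNReal.mul_inv_cancel hN (ENNReal.natCast_ne_top N), one_mul]
  have hbound : ∀ ω, ∑' k, g k (x k ω) (i (k + 1) ω) ≤ ENNReal.ofReal M := by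
    intro ω
    refine ENNReal.tsum_le_of_sum_range_le fun n => ?_
    simp only [g]
    rw [← ENNReal.ofReal_sum_of_nonneg fun k _ => hterm k _ _]
    exact ENNReal.ofReal_le_ofReal (hM ω n)
  have hsmeas : ∀ k, Measurable fun ω => ∑ j, g k (x k ω) j := fun k =>
    hmeas (fun z _ => ∑ j, g k z j) k
  have htotal : ∫⁻ ω, ∑' k, ∑ j, g k (x k ω) j ∂P ≠ ⊤ := by
    rw [lintegral_tsum fun k => (hsmeas k).aemeasurable]
    simp only [hmean]
    rw [ENNReal.tsum_mul_left, ← lintegral_tsum fun k => (hmeas (g k) k).aemeasurable]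
    refine ENNReal.mul_ne_top (ENNReal.natCast_ne_top N) (ne_top_of_le_ne_top ?_
      (lintegral_mono hbound))
    simp
  filter_upwards [ae_lt_top (Measurable.tsum hsmeas) htotal] with ω hω
  refine (ENNReal.summable_toReal hω.ne).congr fun k => ?_
  rw [← hgsum, ENNReal.toReal_ofReal (mul_nonneg (hμ k).le (totalResidual_nonneg _))]

end Random

/-! ### Step sizes and solutions -/

theorem exists_pos_le_of_tendsto {u : ℕ → ℝ} {l : ℝ} (hl : 0 < l) (hu : ∀ k, 0 < u k)
    (h : Tendsto u atTop (𝓝 l)) : ∃ c, 0 < c ∧ ∀ k, c ≤ u k := by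
  obtain ⟨M, hM⟩ := eventually_atTop.1 (h.eventually_const_lt (half_lt_self hl))
  obtain ⟨k₀, -, hk₀⟩ := Finset.exists_min_image (Finset.range (M + 1)) u ⟨0, by simp⟩
  refine ⟨min (l / 2) (u k₀), lt_min (half_pos hl) (hu k₀), fun k => ?_⟩
  rcases le_total M k with hk | hk
  · exact (min_le_left _ _).trans (hM k hk).le
  · exact (min_le_right _ _).trans (hk₀ k (Finset.mem_range.2 (by lia)))

/-- The factors of the residuals in the descent estimates of all steps have a common positive
lower bound, since the step sizes tend to `0`. -/
theorem exists_descent_factor {s a : ℝ} (hs : 1 < s) {m : ℕ → ℝ} (hm : ∀ k, 0 < m k)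
    (hsum : Summable fun k => m k ^ s) (h : ∀ k, m k ^ (s - 1) * a < s) :
    ∃ c, 0 < c ∧ ∀ k, c ≤ 1 - m k ^ (s - 1) * a / s := by
  have hs0 : 0 < s := by linarith
  refine exists_pos_le_of_tendsto one_pos (fun k => ?_) ?_
  · rw [sub_pos, div_lt_one hs0]
    exact h k
  · have h1 : Tendsto (fun k => (m k ^ s) ^ ((s - 1) / s)) atTop (𝓝 0) := by
      have := hsum.tendsto_atTop_zero.rpow_const (p := (s - 1) / s)
        (Or.inr (div_nonneg (by linarith) hs0.le))
      rwa [Real.zero_rpow (div_ne_zero (by linarith) hs0.ne')] at this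
    have h2 : Tendsto (fun k => m k ^ (s - 1)) atTop (𝓝 0) := by
      refine h1.congr fun k => ?_
      rw [← Real.rpow_mul (hm k).le, mul_div_cancel₀ _ hs0.ne']
    simpa using ((h2.mul_const a).div_const s).const_sub 1

theorem stack_eq_iff {X : Type*} [NormedAddCommGroup X] [NormedSpace ℝ X] {N : ℕ}
    {Y : Fin N → Type*} [∀ j, NormedAddCommGroup (Y j)] [∀ j, NormedSpace ℝ (Y j)]
    {r : ℝ≥0∞} [Fact (1 ≤ r)] {A : ∀ j, X →L[ℝ] Y j} {y : PiLp r Y} {x : X} :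
    stack r A x = y ↔ ∀ j, A j x = y j :=
  ⟨fun h _ => h ▸ rfl, fun h => PiLp.ext h⟩

theorem mem_minimisers {X Z : Type*} [NormedAddCommGroup X] [NormedSpace ℝ X]
    [NormedAddCommGroup Z] [NormedSpace ℝ Z] {p : ℝ} (hp : 0 < p) {T : X →L[ℝ] Z} {y : Z} {x : X}
    (h : T x = y) : x ∈ minimisers p T y := by
  intro z _
  simp only [Set.mem_ofPred_eq, h, sub_self, norm_zero, Real.zero_rpow hp.ne', mul_zero]
  positivity

end BanachSGD


/-! ### Almost sure convergence and convergence of the means -/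

theorem theorem3p11
    {X : Type*} [NormedAddCommGroup X] [NormedSpace ℝ X] [CompleteSpace X]
    (p : ℝ) (hp : 2 ≤ p) (hconv : BanachSGD.IsPConvex X p) (hsmooth : BanachSGD.IsSmoothSpace X)
    {N : ℕ} {Y : Fin N → Type*} [∀ j, NormedAddCommGroup (Y j)] [∀ j, NormedSpace ℝ (Y j)]
    [∀ j, CompleteSpace (Y j)]
    (r : ℝ≥0∞) [Fact (1 ≤ r)]
    (A : ∀ j, X →L[ℝ] Y j) (y : PiLp r Y)
    (hy : ∃ x : X, BanachSGD.stack r A x = y)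
    (q : ℝ) (hq1 : 1 < q) (hq2 : q ≤ 2)
    (jY : ∀ j, Y j → StrongDual ℝ (Y j))
    (hjY : ∀ j v, jY j v ∈ BanachSGD.dualityMap q v)
    {Ω : Type*} [MeasurableSpace Ω] (P : Measure Ω) [IsProbabilityMeasure P]
    (i : ℕ → Ω → Fin N) (hi_meas : ∀ k, Measurable (i (k + 1)))
    (hi_unif : ∀ k j, P {ω | i (k + 1) ω = j} = (N : ℝ≥0∞)⁻¹)
    (hi_indep : iIndepFun (fun k => i (k + 1)) P)
    (x₀ : X) (μ : ℕ → ℝ) (hμ_pos : ∀ k, 0 < μ (k + 1))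
    (hμ_sum : ¬ Summable (fun k => μ (k + 1)))
    (hμ_pow : Summable (fun k => μ (k + 1) ^ p.conjExponent)) :
    (∃ G : ℝ, BanachSGD.IsDualSmoothnessConst X p G) ∧
    ∀ G : ℝ, BanachSGD.IsDualSmoothnessConst X p G →
      (∀ k, μ (k + 1) ^ (p.conjExponent - 1) * (G * (⨆ j, ‖A j‖) ^ p.conjExponent)
        < p.conjExponent) →
      let x : ℕ → Ω → X := fun k ω => BanachSGD.iterates p A y jY μ x₀ (fun n => i n ω) k
      (∀ᵐ ω ∂P, ∃ xhat : X, BanachSGD.stack r A xhat = y ∧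
        Tendsto (fun k => x k ω) atTop (𝓝 xhat)) ∧
      (∀ᵐ ω ∂P, Tendsto
        (fun k => Metric.infDist (x k ω) (BanachSGD.minimisers p (BanachSGD.stack r A) y))
        atTop (𝓝 0)) ∧
      ∀ xdag : X, BanachSGD.IsMinNormSolution (BanachSGD.stack r A) y xdag →
        BanachSGD.dualityFun p x₀ ∈ closure (BanachSGD.adjointRange (BanachSGD.stack r A)) →
        (∀ᵐ ω ∂P, Tendsto (fun k => BanachSGD.bregman p (x k ω) xdag) atTop (𝓝 0)) ∧
        (∀ k, Integrable (fun ω => BanachSGD.bregman p (x k ω) xdag) P) ∧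
        Tendsto (fun k => ∫ ω, BanachSGD.bregman p (x k ω) xdag ∂P) atTop (𝓝 0) := by
  have hp0 : 0 < p := by linarith
  have hp1 : 1 < p := by linarith
  refine ⟨BanachSGD.exists_isDualSmoothnessConst hp hconv, fun G hG hμG => ?_⟩
  have hps : p.HolderConjugate p.conjExponent := .conjExponent hp1
  set s := p.conjExponent with hs
  have hs0 : 0 < s := hps.symm.pos
  set L := ⨆ j, ‖A j‖ with hL
  have hAL : ∀ j, ‖A j‖ ≤ L := le_ciSup (Set.finite_range _).bddAbove
  have hL0 : 0 ≤ L := Real.iSup_nonneg fun _ => norm_nonneg _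
  intro x
  have hxK : ∀ ω, BanachSGD.IsKaczmarzSeq p A y jY μ (fun n => i n ω) fun k => x k ω := fun ω =>
    BanachSGD.isKaczmarzSeq_iterates hp hconv hsmooth x₀
  obtain ⟨c, hc, hcμ⟩ := BanachSGD.exists_descent_factor hps.symm.lt hμ_pos hμ_pow hμG
  set ν : ℕ → ℝ := fun k => 1 / s * G * L ^ s * μ (k + 1) ^ s with hν
  have hG0 := hG.1
  have hνsum : Summable ν := hμ_pow.mul_left _
  have hν0 : ∀ k, 0 ≤ ν k := fun k => by
    have := hμ_pos k
    positivity
  have hD0 : ∀ z v : X, 0 ≤ BanachSGD.bregman p z v := by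
    obtain ⟨C, hC, hD⟩ := BanachSGD.exists_mul_rpow_norm_sub_le hp hps hconv
    intro z v
    exact le_trans (by positivity) (hD z v _ (BanachSGD.dualityFun_mem hp1 z))
  -- the descent estimate, which holds on every path and for every solution `v`
  have hdesc : ∀ ω v, (∀ j, A j v = y j) → ∀ k, BanachSGD.bregman p (x (k + 1) ω) v ≤
      BanachSGD.bregman p (x k ω) v
        - c * (μ (k + 1) * ‖A (i (k + 1) ω) (x k ω) - y (i (k + 1) ω)‖ ^ q) + ν k := by
    intro ω v hv k
    have h1 := BanachSGD.bregman_step_le hp hconv hq1 (hq2.trans hp)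
      (hjY (i (k + 1) ω) (A (i (k + 1) ω) (x k ω) - y (i (k + 1) ω))) (hμ_pos k) hG
      (hAL (i (k + 1) ω)) (hxK ω k) (hv _)
    have h2 := mul_le_mul_of_nonneg_right (hcμ k)
      (mul_nonneg (hμ_pos k).le
        (Real.rpow_nonneg (norm_nonneg (A (i (k + 1) ω) (x k ω) - y (i (k + 1) ω))) q))
    simp only [hν]
    linarith
  have hterm : ∀ ω k, 0 ≤ c * (μ (k + 1) * ‖A (i (k + 1) ω) (x k ω) - y (i (k + 1) ω)‖ ^ q) :=
    fun ω k => mul_nonneg hc.le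
      (mul_nonneg (hμ_pos k).le (Real.rpow_nonneg (norm_nonneg _) _))
  have hsum : ∀ ω v, (∀ j, A j v = y j) → ∀ n, BanachSGD.bregman p (x n ω) v +
      ∑ k ∈ Finset.range n, c * (μ (k + 1) * ‖A (i (k + 1) ω) (x k ω) - y (i (k + 1) ω)‖ ^ q) ≤
      BanachSGD.bregman p x₀ v + ∑' k, ν k := fun ω v hv n =>
    BanachSGD.add_sum_le_of_le_sub_add (a := fun k => BanachSGD.bregman p (x k ω) v) hνsum hν0
      (hdesc ω v hv) n
  obtain ⟨v₀, hv₀⟩ := hy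
  have hv₀' := BanachSGD.stack_eq_iff.1 hv₀
  have hres : ∀ᵐ ω ∂P, Summable fun k => μ (k + 1) *
      BanachSGD.totalResidual q A y (x k ω) := by
    refine BanachSGD.ae_summable_totalResidual
      (M := (BanachSGD.bregman p x₀ v₀ + ∑' k, ν k) / c) hi_meas hi_unif hi_indep hμ_pos
      fun ω n => ?_
    rw [le_div_iff₀ hc, mul_comm, Finset.mul_sum]
    exact (le_add_of_nonneg_left (hD0 _ _)).trans (hsum ω v₀ hv₀' n)
  have hconvergence : ∀ᵐ ω ∂P, ∃ z, (∀ j, A j z = y j) ∧ Tendsto (fun k => x k ω) atTop (𝓝 z) ∧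
      Tendsto (fun k => BanachSGD.bregman p (x k ω) z) atTop (𝓝 0) := by
    filter_upwards [hres] with ω hω
    refine (hxK ω).exists_tendsto hp hconv hq1 hjY hμ_pos hμ_sum ⟨v₀, hv₀'⟩ (fun v hv => ?_) hω
    exact BanachSGD.exists_tendsto_of_le_add_summable (fun k => hD0 _ _) hνsum hν0 fun k => by
      linarith [hdesc ω v hv k, hterm ω k]
  refine ⟨?_, ?_, fun xdag hdag hrange => ?_⟩
  · filter_upwards [hconvergence] with ω ⟨z, hz, hlim, _⟩
    exact ⟨z, BanachSGD.stack_eq_iff.2 hz, hlim⟩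
  · filter_upwards [hconvergence] with ω ⟨z, hz, hlim, _⟩
    refine squeeze_zero (fun k => Metric.infDist_nonneg) (fun k => ?_)
      (tendsto_iff_dist_tendsto_zero.1 hlim)
    exact Metric.infDist_le_dist_of_mem
      (BanachSGD.mem_minimisers hp0 (BanachSGD.stack_eq_iff.2 hz))
  · have hae : ∀ᵐ ω ∂P, Tendsto (fun k => BanachSGD.bregman p (x k ω) xdag) atTop (𝓝 0) := by
      filter_upwards [hconvergence] with ω ⟨z, hz, _, hlim⟩
      exact squeeze_zero (fun k => hD0 _ _)
        (fun k => (hxK ω).bregman_le hp0 hrange hdag (BanachSGD.stack_eq_iff.2 hz) k) hlim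
    have hmeas : ∀ k, AEStronglyMeasurable (fun ω => BanachSGD.bregman p (x k ω) xdag) P :=
      fun k => (BanachSGD.measurable_comp_iterates (P := P) hi_meas
        (fun z _ => BanachSGD.bregman p z xdag) k).aestronglyMeasurable
    -- the bound does not depend on the path, so it serves as a dominating constant
    have hbdd : ∀ k ω, ‖BanachSGD.bregman p (x k ω) xdag‖ ≤
        BanachSGD.bregman p x₀ xdag + ∑' k, ν k := fun k ω => by
      rw [Real.norm_of_nonneg (hD0 _ _)]
      exact (le_add_of_nonneg_right (Finset.sum_nonneg fun l _ => hterm ω l)).trans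
        (hsum ω xdag (BanachSGD.stack_eq_iff.1 hdag.1) k)
    refine ⟨hae, fun k => .of_bound (hmeas k) _ (.of_forall (hbdd k)), ?_⟩
    simpa using tendsto_integral_of_dominated_convergence (f := fun _ => (0 : ℝ))
      (fun _ => BanachSGD.bregman p x₀ xdag + ∑' k, ν k) hmeas (integrable_const _)
      (fun k => .of_forall (hbdd k)) hae
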